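/- Let $k$ be a finite field with $q$ elements, $A=k[t]$, $K=\operatorname{Frac}A$, and let $\mathfrak p\subset A$ be a nonzero prime ideal of degree $d$, so that $A/\mathfrak p$ is a field with $q^d$ elements. For an $A$-algebra $E$ let $C(E)$ be the Carlitz module over $E$: the additive group of $E$ with the $k[t]$-module structure, denoted $\varphi$, in which elements of $k$ act by multiplication and $t$ acts by $x\mapsto tx+x^q$. Let $L/K$ be the splitting field of the $\mathfrak p$-torsion $C[\mathfrak p]$ (that is, of the polynomial $\varphi(f)(x)$, where $\mathfrak p=(f)$), let $G=\operatorname{Gal}(L/K)$, and let $\chi\colon G\to(A/\mathfrak p)^\times$ be the character through which $G$ acts on the one-dimensional $A/\mathfrak p$-vector space $C[\mathfrak p](L)$. Let $R$ be the integral closure of $A$ in $L$, $Y=\operatorname{Spec}R$, and let $\mathfrak P\subset R$ be the unique prime above $\mathfrak p$. Let $\lambda\in L$ be a generator of the $A/\mathfrak p$-module $C[\mathfrak p](L)$. It is an invertible function on $Y-\mathfrak P$; let $$1\otimes\lambda=\sum_{n=1}^{q^d-1}\lambda_n\quad\text{in}\quad A/\mathfrak p\otimes_{\mathbf Z}\Gamma(Y-\mathfrak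 P,\mathcal O_Y^\times)$$ be its decomposition into isotypical components, where $g\lambda_n=\chi(g)^n\lambda_n$ for all $g\in G$ ($G$ acting through the second factor). Let $e(z)=z+e_1z^q+e_2z^{q^2}+\cdots\in K[[z]]$ be the Carlitz exponential, the unique power series of this form with $e(tz)=e(z)^q+te(z)$, and define $BC_n\in K$ by $z/e(z)=\sum_{n\ge0}BC_nz^n$. Let $\Omega_R=\Omega_{R/k}$ be the module of Kähler differentials and let $$\operatorname{dlog}\colon A/\mathfrak p\otimes_{\mathbf Z}\Gamma(Y,\mathcal O_Y^\times)\to A/\mathfrak p\otimes_k\Omega_R,\qquad a\otimes u\mapsto a\otimes\tfrac{du}{u}.$$ For $m\ge 0$ the ring $R/\mathfrak P^m$ is an $A/\mathfrak p$-algebra through the unique $k$-algebra homomorphism $A/\mathfrak p\to R/\mathfrak P^m$ lifting the natural map $A/\mathfrak p\to R/\mathfrak P$, so that the quotient map $\Omega_R\to\Omega_R/\mathfrak P^m\Omega_R$ extends to an $A/\mathfrak p$-linear map $A/\mathfrak p\otimes_k\Omega_R\to\Omega_R/\mathfrak P^m\Omega_R$. Theorem. If $1\le n<q^d-1$, then $\lambda_n\in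 A/\mathfrak p\otimes_{\mathbf Z}\Gamma(Y,\mathcal O_Y^\times)$ (which the restriction map identifies with a subspace of $A/\mathfrak p\otimes_{\mathbf Z}\Gamma(Y-\mathfrak P,\mathcal O_Y^\times)$), and the following are equivalent: 1. $\mathfrak p$ divides $BC_n$, i.e. $BC_n$ has positive $\mathfrak p$-adic valuation (or is zero); 2. $\operatorname{dlog}\lambda_n$ lies in the kernel of $A/\mathfrak p\otimes_k\Omega_R\to\Omega_R/\mathfrak P^{q^d}\Omega_R$. -/

import Mathlib

open Polynomial TensorProduct IsDedekindDomain

noncomputable section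

namespace Carlitz

/-! ### The Carlitz module `C` over `A = k[t]`, with `q = #k` -/

section CarlitzModule

variable (k : Type*) [Field k] [Fintype k]

/-- The action `φ(t) = t + F` of `t` on the additive group of a `k[t]`-algebra `E`, where
`F x = x ^ q`. -/
def op (E : Type*) [CommRing E] [Algebra k E] [Algebra k[X] E] : Module.End k E :=
  LinearMap.mulLeft k (algebraMap k[X] E X) + (FiniteField.frobeniusAlgHom k E).toLinearMap

/-- The `k[t]`-module `C(E)`: the `k`-vector space `E`, with `t` acting as `φ(t) = t + F`. -/
abbrev Points (E : Type*) [CommRing E] [Algebra k E] [Algebra k[X] E] : Type _ :=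
  Module.AEval' (op k E)

/-- The element of `C(E)` given by an element of `E`. -/
abbrev toPoints (E : Type*) [CommRing E] [Algebra k E] [Algebra k[X] E] : E ≃ₗ[k] Points k E :=
  Module.AEval'.of (op k E)

variable {k} in
/-- The `𝔭`-torsion `C[𝔭](E)`; it is a module over `A/𝔭`. -/
abbrev Torsion (𝔭 : HeightOneSpectrum k[X])
    (E : Type*) [CommRing E] [Algebra k E] [Algebra k[X] E] : Submodule k[X] (Points k E) :=
  Submodule.torsionBySet k[X] (Points k E) 𝔭.asIdeal

variable {k} in
/-- The element of `E` underlying a torsion point. -/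
def torsionCoord {𝔭 : HeightOneSpectrum k[X]} {E : Type*} [CommRing E] [Algebra k E]
    [Algebra k[X] E] (x : Torsion 𝔭 E) : E :=
  (toPoints k E).symm (x : Points k E)

variable {k} in
/-- The polynomial `φ(a)(x) ∈ K[x]`: the action of `a` on the generic point `x ∈ C(K[x])`. -/
def poly (K : Type*) [Field K] [Algebra k K] [Algebra k[X] K] (a : k[X]) : K[X] :=
  (toPoints k K[X]).symm (a • toPoints k K[X] X)

variable {k} in
/-- `L` is a splitting field over `K` of the finite group scheme `C[𝔭]_K`: writing `𝔭 = (f)`, this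
group scheme is the zero locus of `φ(f)(x)` in the affine line. -/
def IsTorsionSplittingField (𝔭 : HeightOneSpectrum k[X]) (K L : Type*) [Field K] [Algebra k K]
    [Algebra k[X] K] [Field L] [Algebra K L] : Prop :=
  ∃ f : k[X], 𝔭.asIdeal = Ideal.span {f} ∧ (poly K f).IsSplittingField K L

end CarlitzModule

/-! ### The Galois representation on `C[𝔭](L)` and the character `χ` -/

section Galois

variable {k : Type*} [Field k] [Fintype k] (𝔭 : HeightOneSpectrum k[X])
  {K : Type*} [Field K] [Algebra k[X] K]
  {L : Type*} [Field L] [Algebra k L] [Algebra k[X] L] [IsScalarTower k k[X] L]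
  [Algebra K L] [IsScalarTower k[X] K L]

/-- An automorphism of `L` over `K`, as an automorphism over `A = k[t]`. -/
abbrev overA (g : L ≃ₐ[K] L) : L ≃ₐ[k[X]] L := g.restrictScalars k[X]

/-- The action of a Galois automorphism on `C(L)`. -/
def galPoints (g : L ≃ₐ[K] L) : Points k L →ₗ[k[X]] Points k L :=
  LinearMap.ofAEval (op k L)
    ((toPoints k L).toLinearMap ∘ₗ ((overA (k := k) g).restrictScalars k).toLinearMap)
    (fun m => by
      have h : g (algebraMap k[X] L X) = algebraMap k[X] L X := (overA (k := k) g).commutes X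
      refine Eq.trans ?_ (Module.AEval'.X_smul_of (op k L) (g m)).symm
      change toPoints k L (g (algebraMap k[X] L X * m + m ^ Fintype.card k)) =
        toPoints k L (algebraMap k[X] L X * g m + g m ^ Fintype.card k)
      rw [map_add, map_mul, map_pow, h])

theorem galPoints_apply (g : L ≃ₐ[K] L) (x : L) :
    galPoints (k := k) g (toPoints k L x) = toPoints k L (g x) := rfl

/-- The action of a Galois automorphism on `C[𝔭](L)`. -/
def galTorsion (g : L ≃ₐ[K] L) : Torsion 𝔭 L →ₗ[k[X] ⧸ 𝔭.asIdeal] Torsion 𝔭 L where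
  toFun x := ⟨galPoints g x.1, by
    have hx := (Submodule.mem_torsionBySet_iff _ _).1 x.2
    rw [Submodule.mem_torsionBySet_iff]
    intro a
    rw [← map_smul, hx a, map_zero]⟩
  map_add' x y := Subtype.ext (map_add (galPoints g) x.1 y.1)
  map_smul' a x := by
    obtain ⟨a, rfl⟩ := Ideal.Quotient.mk_surjective a
    exact Subtype.ext (map_smul (galPoints g) a x.1)

/-- The representation `ρ` of `Gal(L/K)` on the `A/𝔭`-module `C[𝔭](L)`. -/
def rep : (L ≃ₐ[K] L) →* Module.End (k[X] ⧸ 𝔭.asIdeal) (Torsion 𝔭 L) where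
  toFun g := galTorsion 𝔭 g
  map_one' := rfl
  map_mul' _ _ := rfl

/-- The character `χ : Gal(L/K) → A/𝔭` through which `Gal(L/K)` acts on `C[𝔭](L)`. When `C[𝔭](L)`
is generated by one element, this is the scalar by which `ρ(g)` acts (see `rep_apply_eq_chi_smul`);
the determinant gives it without the choice of a generator. -/
def chi : (L ≃ₐ[K] L) →* k[X] ⧸ 𝔭.asIdeal := LinearMap.det.comp (rep 𝔭)

theorem rep_apply_eq_chi_smul (lam : Torsion 𝔭 L)
    (hlam : Submodule.span (k[X] ⧸ 𝔭.asIdeal) {lam} = ⊤) (g : L ≃ₐ[K] L) (x : Torsion 𝔭 L) :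
    rep 𝔭 g x = chi 𝔭 g • x := by
  let _ : Field (k[X] ⧸ 𝔭.asIdeal) := Ideal.Quotient.field _
  have hmem : ∀ y : Torsion 𝔭 L, ∃ c : k[X] ⧸ 𝔭.asIdeal, c • lam = y := fun y =>
    Submodule.mem_span_singleton.1 (hlam ▸ Submodule.mem_top)
  obtain ⟨c, hc⟩ := hmem (rep 𝔭 g lam)
  have hrep : rep 𝔭 g = c • LinearMap.id := by
    ext1 y
    obtain ⟨b, rfl⟩ := hmem y
    rw [map_smul, ← hc, LinearMap.smul_apply, LinearMap.id_apply, smul_comm]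
  by_cases h0 : lam = 0
  · obtain ⟨b, rfl⟩ := hmem x
    rw [h0, smul_zero, map_zero, smul_zero]
  · have h1 : Module.finrank (k[X] ⧸ 𝔭.asIdeal) (Torsion 𝔭 L) = 1 :=
      finrank_eq_one lam h0 hmem
    rw [chi, MonoidHom.comp_apply, hrep, LinearMap.det_smul, h1, LinearMap.det_id, pow_one, mul_one,
      LinearMap.smul_apply, LinearMap.id_apply]

end Galois

/-! ### Functions on `Y = Spec R` and on `Y - 𝔓` -/

section Units

variable {k : Type*} [Field k] [Fintype k] (𝔭 : HeightOneSpectrum k[X])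
  {K : Type*} [Field K] [Algebra k[X] K]

/-- The integral closure `R` of `A = k[t]` in `L`. -/
abbrev IntClosure (k L : Type*) [Field k] [Field L] [Algebra k[X] L] : Subalgebra k[X] L :=
  integralClosure k[X] L

/-- The ring `Γ(Y - 𝔓, O_Y)` as a subring of the function field `L` of `Y = Spec R`: the elements of
`L` that lie in the local ring `R_𝔮` for all points `𝔮` of `Y` that do not lie above `𝔭`.
(The only point of `Y` above `𝔭` is `𝔓`.) -/
def PuncturedSections (L : Type*) [Field L] [Algebra k[X] L] : Subalgebra (IntClosure k L) L where
  carrier := {x | ∀ 𝔮 : Ideal (IntClosure k L), 𝔮.IsPrime → ¬ 𝔮.LiesOver 𝔭.asIdeal →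
    ∃ a s : IntClosure k L, s ∉ 𝔮 ∧ (s : L) * x = a}
  mul_mem' {x y} hx hy 𝔮 h𝔮 h := by
    obtain ⟨a, s, hs, ha⟩ := hx 𝔮 h𝔮 h
    obtain ⟨b, r, hr, hb⟩ := hy 𝔮 h𝔮 h
    refine ⟨a * b, s * r, fun hm => (h𝔮.mem_or_mem hm).elim hs hr, ?_⟩
    push_cast
    rw [← ha, ← hb]
    ring
  add_mem' {x y} hx hy 𝔮 h𝔮 h := by
    obtain ⟨a, s, hs, ha⟩ := hx 𝔮 h𝔮 h
    obtain ⟨b, r, hr, hb⟩ := hy 𝔮 h𝔮 h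
    refine ⟨r * a + s * b, s * r, fun hm => (h𝔮.mem_or_mem hm).elim hs hr, ?_⟩
    push_cast
    rw [← ha, ← hb]
    ring
  algebraMap_mem' r 𝔮 h𝔮 h :=
    ⟨r, 1, fun h1 => h𝔮.ne_top ((Ideal.eq_top_iff_one _).2 h1), by simp⟩

variable {L : Type*} [Field L] [Algebra k[X] L] [Algebra K L] [IsScalarTower k[X] K L]

/-- The action of a Galois automorphism on `Γ(Y - 𝔓, O_Y)`. -/
def galSections (g : L ≃ₐ[K] L) : PuncturedSections 𝔭 L →* PuncturedSections 𝔭 L where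
  toFun x := ⟨g x, fun 𝔮 h𝔮 h => by
    have := h𝔮
    let σ := (overA (k := k) g).mapIntegralClosure
    have hlie : ¬ (𝔮.comap σ).LiesOver 𝔭.asIdeal := by
      rintro ⟨h'⟩
      refine h ⟨h'.trans ?_⟩
      ext a
      simp [Ideal.mem_comap, Ideal.under]
    obtain ⟨a, s, hs, ha⟩ := x.2 (𝔮.comap σ) (Ideal.comap_isPrime _ _) hlie
    refine ⟨σ a, σ s, hs, ?_⟩
    have h1 : ∀ r : IntClosure k L, ((σ r : IntClosure k L) : L) = g r := fun _ => rfl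
    rw [h1, h1, ← ha, map_mul]⟩
  map_one' := Subtype.ext (map_one g)
  map_mul' x y := Subtype.ext (map_mul g (x : L) (y : L))

/-- The `A/𝔭`-module `A/𝔭 ⊗_ℤ Γ(Y, O_Y^×) = A/𝔭 ⊗_ℤ R^×`. -/
abbrev UnitClasses (L : Type*) [Field L] [Algebra k[X] L] : Type _ :=
  (k[X] ⧸ 𝔭.asIdeal) ⊗[ℤ] Additive (IntClosure k L)ˣ

/-- The `A/𝔭`-module `A/𝔭 ⊗_ℤ Γ(Y - 𝔓, O_Y^×)`. -/
abbrev PuncturedUnitClasses (L : Type*) [Field L] [Algebra k[X] L] : Type _ :=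
  (k[X] ⧸ 𝔭.asIdeal) ⊗[ℤ] Additive (PuncturedSections 𝔭 L)ˣ

/-- The restriction map `A/𝔭 ⊗ Γ(Y, O_Y^×) → A/𝔭 ⊗ Γ(Y - 𝔓, O_Y^×)`. -/
def restrict (L : Type*) [Field L] [Algebra k[X] L] :
    UnitClasses 𝔭 L →ₗ[k[X] ⧸ 𝔭.asIdeal] PuncturedUnitClasses 𝔭 L :=
  LinearMap.baseChange (k[X] ⧸ 𝔭.asIdeal) (AddMonoidHom.toIntLinearMap (MonoidHom.toAdditive
    (Units.map (algebraMap (IntClosure k L) (PuncturedSections 𝔭 L)).toMonoidHom)))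

/-- The action of a Galois automorphism on `A/𝔭 ⊗ Γ(Y - 𝔓, O_Y^×)` through the second factor. -/
def galClasses (g : L ≃ₐ[K] L) :
    PuncturedUnitClasses 𝔭 L →ₗ[k[X] ⧸ 𝔭.asIdeal] PuncturedUnitClasses 𝔭 L :=
  LinearMap.baseChange (k[X] ⧸ 𝔭.asIdeal) (AddMonoidHom.toIntLinearMap (MonoidHom.toAdditive
    (Units.map (galSections 𝔭 g))))

variable (K) in
/-- `m = ∑_{n = 1}^{q^d - 1} ℓ n` with `ℓ n` in the `χ^n`-isotypical component of
`A/𝔭 ⊗ Γ(Y - 𝔓, O_Y^×)`; here `d` is the degree of `𝔭`, the dimension of `A/𝔭` over `k`. -/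
def IsIsotypicDecomposition [Algebra k L] [IsScalarTower k k[X] L]
    (m : PuncturedUnitClasses 𝔭 L) (ℓ : ℕ → PuncturedUnitClasses 𝔭 L) : Prop :=
  (∀ n ∈ Finset.Icc 1 (Fintype.card k ^ Module.finrank k (k[X] ⧸ 𝔭.asIdeal) - 1),
    ∀ g : L ≃ₐ[K] L, galClasses 𝔭 g (ℓ n) = chi 𝔭 g ^ n • ℓ n) ∧
  m = ∑ n ∈ Finset.Icc 1 (Fintype.card k ^ Module.finrank k (k[X] ⧸ 𝔭.asIdeal) - 1), ℓ n

end Units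

/-! ### Differentials -/

section Differentials

variable {k : Type*} [Field k] [Fintype k] (𝔭 : HeightOneSpectrum k[X])
  {R : Type*} [CommRing R] [Algebra k R]

/-- The logarithmic differential `u ↦ u⁻¹ du` from `R^×` to `Ω_{R/k}`. -/
def dlogHom (k R : Type*) [Field k] [CommRing R] [Algebra k R] : Additive Rˣ →+ Ω[R⁄k] where
  toFun u := ((u.toMul⁻¹ : Rˣ) : R) • KaehlerDifferential.D k R (u.toMul : R)
  map_zero' := by simp
  map_add' u v := by
    have h1 : ∀ a b : Rˣ, (((a * b)⁻¹ : Rˣ) : R) * (a : R) = ((b⁻¹ : Rˣ) : R) := fun a b => by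
      rw [← Units.val_mul, mul_inv_rev, inv_mul_cancel_right]
    rw [toMul_add, Units.val_mul, Derivation.leibniz, smul_add, smul_smul, smul_smul, h1, mul_comm,
      mul_comm u.toMul, mul_comm, h1, add_comm]

/-- The map `A/𝔭 ⊗_ℤ R^× → A/𝔭 ⊗_k Ω_{R/k}`, `a ⊗ u ↦ a ⊗ u⁻¹ du`. -/
def dlog : (k[X] ⧸ 𝔭.asIdeal) ⊗[ℤ] Additive Rˣ →+ (k[X] ⧸ 𝔭.asIdeal) ⊗[k] Ω[R⁄k] :=
  (TensorProduct.lift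
    (LinearMap.mk₂ ℤ (fun (a : k[X] ⧸ 𝔭.asIdeal) (u : Additive Rˣ) => a ⊗ₜ[k] dlogHom k R u)
      (fun a b u => TensorProduct.add_tmul a b _)
      (fun c a u => by rw [TensorProduct.smul_tmul'])
      (fun a u v => by rw [map_add, TensorProduct.tmul_add])
      (fun c a u => by rw [map_zsmul, TensorProduct.tmul_smul]))).toAddMonoidHom

variable [Algebra k[X] R] [IsScalarTower k k[X] R]

/-- The residue field `A/𝔭` is étale over `k`. -/
theorem formallyEtale_quotient : Algebra.FormallyEtale k (k[X] ⧸ 𝔭.asIdeal) := by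
  obtain ⟨f, hf⟩ := (IsPrincipalIdealRing.principal 𝔭.asIdeal).principal
  have hf0 : f ≠ 0 := fun h => 𝔭.ne_bot (by rw [hf, h]; simp)
  let _ : Field (k[X] ⧸ 𝔭.asIdeal) := Ideal.Quotient.field _
  have : Module.Finite k (k[X] ⧸ 𝔭.asIdeal) := by
    rw [hf]
    exact (AdjoinRoot.powerBasis hf0).finite
  have : Algebra.IsSeparable k (k[X] ⧸ 𝔭.asIdeal) := inferInstance
  exact Algebra.FormallyEtale.of_isSeparable k (k[X] ⧸ 𝔭.asIdeal)

theorem isNilpotent_map_quotient_pow (𝔓 : Ideal R) (m : ℕ) :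
    IsNilpotent (𝔓.map (Ideal.Quotient.mk (𝔓 ^ m))) :=
  ⟨m, by rw [← Ideal.map_pow, Ideal.map_quotient_self]; rfl⟩

/-- The natural map from `A/𝔭` to the residue ring of `R/𝔓^m` modulo the image of `𝔓`
(that is, to `R/𝔓`). -/
def toResidue (𝔓 : Ideal R) [𝔓.LiesOver 𝔭.asIdeal] (m : ℕ) :
    (k[X] ⧸ 𝔭.asIdeal) →ₐ[k] (R ⧸ 𝔓 ^ m) ⧸ 𝔓.map (Ideal.Quotient.mk (𝔓 ^ m)) :=
  Ideal.Quotient.liftₐ 𝔭.asIdeal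
    (((Ideal.Quotient.mkₐ k (𝔓.map (Ideal.Quotient.mk (𝔓 ^ m)))).comp
      (Ideal.Quotient.mkₐ k (𝔓 ^ m))).comp (IsScalarTower.toAlgHom k k[X] R))
    (fun a ha => Ideal.Quotient.eq_zero_iff_mem.2 (Ideal.mem_map_of_mem _
      ((Ideal.mem_of_liesOver 𝔓 𝔭.asIdeal a).1 ha)))

/-- The `A/𝔭`-algebra structure of `R/𝔓^m`: the `k`-algebra homomorphism `A/𝔭 → R/𝔓^m` that lifts
`A/𝔭 → R/𝔓`. It exists and is unique because `A/𝔭` is étale over `k`. -/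
def coeffLift (𝔓 : Ideal R) [𝔓.LiesOver 𝔭.asIdeal] (m : ℕ) :
    (k[X] ⧸ 𝔭.asIdeal) →ₐ[k] R ⧸ 𝔓 ^ m :=
  haveI := formallyEtale_quotient 𝔭
  Algebra.FormallySmooth.lift (𝔓.map (Ideal.Quotient.mk (𝔓 ^ m)))
    (isNilpotent_map_quotient_pow 𝔓 m) (toResidue 𝔭 𝔓 m)

theorem eq_coeffLift_iff (𝔓 : Ideal R) [𝔓.LiesOver 𝔭.asIdeal] (m : ℕ)
    (s : (k[X] ⧸ 𝔭.asIdeal) →ₐ[k] R ⧸ 𝔓 ^ m) :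
    s = coeffLift 𝔭 𝔓 m ↔ (Ideal.Quotient.mkₐ k _).comp s = toResidue 𝔭 𝔓 m := by
  have := formallyEtale_quotient 𝔭
  have h := Algebra.FormallySmooth.comp_lift (𝔓.map (Ideal.Quotient.mk (𝔓 ^ m)))
    (isNilpotent_map_quotient_pow 𝔓 m) (toResidue 𝔭 𝔓 m)
  exact ⟨fun hs => hs ▸ h, fun hs => Algebra.FormallyUnramified.ext _
    (isNilpotent_map_quotient_pow 𝔓 m) fun x => (DFunLike.congr_fun (hs.trans h.symm) x :)⟩

/-- The map `A/𝔭 ⊗_k Ω_{R/k} → Ω_{R/k} / 𝔓^m Ω_{R/k}` that extends the quotient map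
`A/𝔭`-linearly. -/
def reduceDifferentials (𝔓 : Ideal R) [𝔓.LiesOver 𝔭.asIdeal] (m : ℕ) :
    (k[X] ⧸ 𝔭.asIdeal) ⊗[k] Ω[R⁄k] →ₗ[k] Ω[R⁄k] ⧸ (𝔓 ^ m • ⊤ : Submodule R Ω[R⁄k]) :=
  TensorProduct.lift
    (LinearMap.mk₂ k (fun a ω => coeffLift 𝔭 𝔓 m a • Submodule.Quotient.mk ω)
      (fun a b ω => by rw [map_add, add_smul])
      (fun c a ω => by rw [map_smul, smul_assoc])
      (fun a ω η => by rw [Submodule.Quotient.mk_add, smul_add])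
      (fun c a ω => by rw [Submodule.Quotient.mk_smul, smul_comm]))

end Differentials

/-! ### The Carlitz exponential and the numbers `BC_n` -/

section Exponential

variable (k : Type*) [Field k] [Fintype k] (K : Type*) [Field K] [Algebra k[X] K]

/-- The coefficient of `z ^ (q ^ i)` in the Carlitz exponential. -/
def expCoeff : ℕ → K
  | 0 => 1
  | i + 1 => expCoeff i ^ Fintype.card k /
      (algebraMap k[X] K X ^ Fintype.card k ^ (i + 1) - algebraMap k[X] K X)

/-- The Carlitz exponential `e(z) = ∑_i e_i z ^ (q ^ i)`. -/
def exp : PowerSeries K :=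
  PowerSeries.mk fun j => ∑ i ∈ Finset.range (j + 1),
    if j = Fintype.card k ^ i then expCoeff k K i else 0

/-- The defining properties of the Carlitz exponential: `e(z) = z + e_1 z^q + e_2 z^{q^2} + ⋯` and
`e(t z) = e(z)^q + t e(z)`. -/
def IsExponential (e : PowerSeries K) : Prop :=
  (∃ c : ℕ → K, c 0 = 1 ∧ (∀ i, PowerSeries.coeff (Fintype.card k ^ i) e = c i) ∧
    ∀ j, (∀ i, j ≠ Fintype.card k ^ i) → PowerSeries.coeff j e = 0) ∧
  PowerSeries.rescale (algebraMap k[X] K X) e =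
    e ^ Fintype.card k + PowerSeries.C (algebraMap k[X] K X) * e

theorem coeff_exp_pow (i : ℕ) :
    PowerSeries.coeff (Fintype.card k ^ i) (exp k K) = expCoeff k K i := by
  have hq : 1 < Fintype.card k := Fintype.one_lt_card
  rw [exp, PowerSeries.coeff_mk, Finset.sum_eq_single i]
  · simp
  · intro j _ hj
    rw [if_neg]
    exact fun h => hj (Nat.pow_right_injective hq h).symm
  · intro h
    exact absurd (Finset.mem_range.2 (Nat.lt_succ_of_lt (Nat.lt_pow_self hq))) h

theorem coeff_exp_of_ne (j : ℕ) (hj : ∀ i, j ≠ Fintype.card k ^ i) :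
    PowerSeries.coeff j (exp k K) = 0 := by
  rw [exp, PowerSeries.coeff_mk]
  exact Finset.sum_eq_zero fun i _ => if_neg (hj i)

theorem coeff_pow_card (e : PowerSeries K) (n : ℕ) :
    PowerSeries.coeff n (e ^ Fintype.card k) =
      if Fintype.card k ∣ n then PowerSeries.coeff (n / Fintype.card k) e ^ Fintype.card k
      else 0 := by
  obtain ⟨p, hchar, r, hp, hr⟩ := FiniteField.card' k
  have : Fact p.Prime := ⟨hp⟩
  have : CharP K p := charP_of_injective_ringHom ((algebraMap k[X] K).comp C).injective p
  have h : PowerSeries.map (iterateFrobenius K p r)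
      (PowerSeries.expand (p ^ (r : ℕ)) (pow_ne_zero _ hp.ne_zero) e) = e ^ p ^ (r : ℕ) :=
    MvPowerSeries.map_iterateFrobenius_expand (R := K) p hp.ne_zero e r
  simp only [hr]
  rw [← h, PowerSeries.coeff_map, PowerSeries.coeff_expand, iterateFrobenius_def]
  split_ifs
  · rfl
  · exact zero_pow (pow_ne_zero _ hp.ne_zero)

theorem isExponential_iff [IsFractionRing k[X] K] (e : PowerSeries K) :
    IsExponential k K e ↔ e = exp k K := by
  have hq : 1 < Fintype.card k := Fintype.one_lt_card
  have ht : ∀ i : ℕ, algebraMap k[X] K X ^ Fintype.card k ^ (i + 1) - algebraMap k[X] K X ≠ 0 := by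
    intro i h
    rw [sub_eq_zero, ← map_pow] at h
    have h1 := congrArg natDegree (IsFractionRing.injective k[X] K h)
    rw [natDegree_X_pow, natDegree_X] at h1
    exact (Nat.one_lt_pow (Nat.succ_ne_zero i) hq).ne' h1
  constructor
  · rintro ⟨⟨c, hc0, hc, hne⟩, hfun⟩
    have hc' : ∀ i, c i = expCoeff k K i := by
      intro i
      induction i with
      | zero => exact hc0
      | succ i ih =>
        have h := congrArg (PowerSeries.coeff (Fintype.card k ^ (i + 1))) hfun
        rw [PowerSeries.coeff_rescale, map_add, PowerSeries.coeff_C_mul, coeff_pow_card,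
          if_pos (dvd_pow_self _ (Nat.succ_ne_zero i)), pow_succ (Fintype.card k) i,
          Nat.mul_div_cancel _ (by omega), ← pow_succ (Fintype.card k) i, hc, hc, ih] at h
        rw [expCoeff, eq_div_iff (ht i)]
        linear_combination h
    ext j
    by_cases hj : ∃ i, j = Fintype.card k ^ i
    · obtain ⟨i, rfl⟩ := hj
      rw [hc, coeff_exp_pow, hc']
    · rw [not_exists] at hj
      rw [hne j hj, coeff_exp_of_ne k K j hj]
  · rintro rfl
    refine ⟨⟨expCoeff k K, rfl, coeff_exp_pow k K, coeff_exp_of_ne k K⟩, ?_⟩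
    ext j
    rw [PowerSeries.coeff_rescale, map_add, PowerSeries.coeff_C_mul, coeff_pow_card]
    by_cases hj : ∃ i, j = Fintype.card k ^ i
    · obtain ⟨i, rfl⟩ := hj
      cases i with
      | zero =>
        have h1 := coeff_exp_pow k K 0
        rw [pow_zero] at h1
        rw [pow_zero, if_neg (by rw [Nat.dvd_one]; exact hq.ne'), h1, pow_one, zero_add]
      | succ i =>
        rw [if_pos (dvd_pow_self _ (Nat.succ_ne_zero i)), coeff_exp_pow, pow_succ (Fintype.card k) i,
          Nat.mul_div_cancel _ (by omega), ← pow_succ (Fintype.card k) i, coeff_exp_pow, expCoeff]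
        have := ht i
        field_simp
        ring
    · rw [not_exists] at hj
      rw [coeff_exp_of_ne k K j hj, mul_zero, mul_zero, add_zero]
      split_ifs with hd
      · obtain ⟨m, rfl⟩ := hd
        rw [Nat.mul_div_cancel_left _ (by omega), coeff_exp_of_ne k K m, zero_pow (by omega)]
        rintro i rfl
        exact hj (i + 1) (by rw [pow_succ'])
      · rfl

/-- The number `BC_n ∈ K`, the coefficient of `z ^ n` in `z / e(z)`, which is the inverse of the
power series `e(z) / z = ∑_j e_{j+1} z ^ j`. -/
def BC (n : ℕ) : K :=
  PowerSeries.coeff n (PowerSeries.mk fun j => PowerSeries.coeff (j + 1) (exp k K))⁻¹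

theorem mk_BC_mul_exp : PowerSeries.mk (BC k K) * exp k K = PowerSeries.X := by
  have h0 : PowerSeries.coeff 0 (exp k K) = 0 := by
    simp [exp]
  have h1 : PowerSeries.coeff 1 (exp k K) = 1 := by
    have : Fintype.card k ≠ 1 := Fintype.one_lt_card.ne'
    simp [exp, Finset.sum_range_succ, expCoeff, this.symm]
  have hexp : exp k K = (PowerSeries.mk fun j => PowerSeries.coeff (j + 1) (exp k K)) *
      PowerSeries.X := by
    ext n
    cases n with
    | zero => simpa using h0
    | succ n => rw [PowerSeries.coeff_succ_mul_X, PowerSeries.coeff_mk]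
  have hBC : PowerSeries.mk (BC k K) =
      (PowerSeries.mk fun j => PowerSeries.coeff (j + 1) (exp k K))⁻¹ := by
    ext n
    rw [PowerSeries.coeff_mk, BC]
  have hne : PowerSeries.constantCoeff
      (PowerSeries.mk fun j => PowerSeries.coeff (j + 1) (exp k K)) ≠ 0 := by
    rw [← PowerSeries.coeff_zero_eq_constantCoeff_apply, PowerSeries.coeff_mk, zero_add, h1]
    exact one_ne_zero
  rw [hBC]
  nth_rewrite 2 [hexp]
  rw [← mul_assoc, PowerSeries.inv_mul_cancel _ hne, one_mul]

end Exponential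

end Carlitz

end

/-! Write F = A/𝔭 and Q = q^d. The derivative of φ(f) is the constant f, so up to a constant f is
the product of the nonzero 𝔭-torsion points up to sign, and these are all associated to λ in R.
Hence f and λ^(Q-1) are associated. Since χ embeds G in F^×, the degree of L/K is at most Q-1.
Therefore 𝔭 is totally ramified, 𝔓 = (λ), the residue field is F and χ is an isomorphism onto F^×
(`torsionField_ramification`). Let g_c correspond to c in F^×, and write g_c λ = u_c λ with u_c in
R^×. Projecting to the isotypical component and using ∑ c^(-n) = 0 gives λ_n = -∑ c^(-n) ⊗ u_c,
which comes from R^×. The preimage is unique because R^× has torsion-free cokernel in the units on Y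
- 𝔓 (`restrict_injective`).

The rest is a computation in B = R/𝔓^Q, a truncated polynomial ring over F. The coefficients e_i
with i < d are 𝔭-integral, so the truncated exponential acts on B, and there is a uniformizer z with
e(z) = λ and B = F[z]/(z^Q). There g_c λ = φ(c)(λ) = e(cz), and e' = 1, so formally dlog u_c =
(c/e(cz) - 1/e(z)) dz. Expanding c/e(cz) = ∑ BC_m c^m z^(m-1) and using orthogonality of characters
of F^×, ∑ c^(-n) dlog u_c = -BC_n z^(n-1) dz (`mul_twistedDlog`).

The division by e(z) is not allowed in B: the identity holds only after multiplication by z², which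
leaves the two top coefficients undetermined. Equivariance under F^× kills them when n > 1, and n =
1 is settled by hand (`twistedDlog_eq_zero_iff`). Finally Ω_R/𝔓^Q Ω_R embeds in B through d/dz
(`exists_injective_of_derivation`), and BC_n over K reduces to BC_n over F
(`valuation_BC_lt_one_iff`). -/

namespace Carlitz

/-! ### The Carlitz exponential modulo z^(q^d) -/

section Truncation

variable (k F : Type*) [Field k] [Fintype k] [Field F] [Algebra k[X] F]

/-- The truncation `∑_{i < d} e_i X ^ (q ^ i)` of the Carlitz exponential. -/
noncomputable def expTrunc (d : ℕ) : F[X] :=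
  ∑ i ∈ Finset.range d, monomial (Fintype.card k ^ i) (expCoeff k F i)

theorem trunc_exp (d : ℕ) : PowerSeries.trunc (Fintype.card k ^ d) (exp k F) = expTrunc k F d := by
  have hq : 1 < Fintype.card k := Fintype.one_lt_card
  ext j
  rw [PowerSeries.coeff_trunc, expTrunc, finsetSum_coeff]
  simp only [coeff_monomial]
  by_cases hj : ∃ i, j = Fintype.card k ^ i
  · obtain ⟨i, rfl⟩ := hj
    rw [coeff_exp_pow]
    simp only [Nat.pow_right_inj hq, Nat.pow_lt_pow_iff_right hq]
    rw [Finset.sum_ite_eq']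
    simp
  · rw [not_exists] at hj
    rw [coeff_exp_of_ne k F j hj, ite_self]
    exact (Finset.sum_eq_zero fun i _ => if_neg fun h => hj i h.symm).symm

/-- This is z/e(z) · e(z) = z modulo z^(q^d). When `F` is the residue field, t^(q^d) = t, so
`expCoeff` divides by zero at index d and takes the value 0. Only coefficients below that index
carry meaning, hence the truncation. -/
theorem X_pow_dvd_trunc_BC_mul_expTrunc (d : ℕ) :
    (X : F[X]) ^ (Fintype.card k ^ d) ∣
      PowerSeries.trunc (Fintype.card k ^ d) (PowerSeries.mk (BC k F)) * expTrunc k F d - X := by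
  rw [X_pow_dvd_iff]
  intro j hj
  have h := congrArg (PowerSeries.coeff j) (mk_BC_mul_exp k F)
  rw [PowerSeries.coeff_mul_eq_coeff_trunc_mul_trunc _ _ hj, trunc_exp] at h
  rw [coeff_sub, ← Polynomial.coeff_coe, Polynomial.coe_mul]
  rw [← Polynomial.coe_mul, Polynomial.coeff_coe] at h ⊢
  rw [h, PowerSeries.coeff_X, coeff_X]
  simp [eq_comm]

theorem expCoeff_zero : expCoeff k F 0 = 1 := rfl

/-- All exponents q^i with i > 0 vanish in `F`, so only the linear term survives; for d = 0 the
truncation would be empty. -/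
theorem derivative_expTrunc_comp (d : ℕ) (hd : d ≠ 0) (c : F) :
    derivative ((expTrunc k F d).comp (C c * X)) = C c := by
  have hq : ((Fintype.card k : ℕ) : F) = 0 := by
    rw [← map_natCast ((algebraMap k[X] F).comp C), FiniteField.cast_card_eq_zero, map_zero]
  rw [expTrunc, Polynomial.sum_comp]
  simp only [monomial_comp, mul_pow, derivative_sum, ← C_pow]
  rw [Finset.sum_eq_single 0]
  · simp [expCoeff_zero]
  · intro i _ hi
    rw [derivative_C_mul, derivative_C_mul, derivative_X_pow, Nat.cast_pow, hq, zero_pow hi]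
    simp
  · intro h
    exact absurd (Finset.mem_range.2 (Nat.pos_of_ne_zero hd)) h

end Truncation

/-! ### The image of t in the residue field -/

section ResidueField

variable {k F : Type*} [Field k] [Fintype k] [Field F] [Algebra k F] [Algebra k[X] F]
  [IsScalarTower k k[X] F]

theorem iterate_frobeniusAlgHom {E : Type*} [CommRing E] [Algebra k E] (j : ℕ) (x : E) :
    (FiniteField.frobeniusAlgHom k E)^[j] x = x ^ Fintype.card k ^ j := by
  induction j with
  | zero => simp
  | succ j ih => rw [Function.iterate_succ_apply', ih, FiniteField.frobeniusAlgHom_apply, ← pow_mul, pow_succ]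

/-- The image of t generates `F` over `k`. If it were fixed by the j-th power of Frobenius, so would
be all of `F`, giving more than q^j roots of X^(q^j) - X. -/
theorem algebraMap_X_pow_card_pow_ne [Fintype F] (hsurj : Function.Surjective (algebraMap k[X] F))
    {d : ℕ} (hd : Fintype.card F = Fintype.card k ^ d) {j : ℕ} (hj : j ≠ 0) (hjd : j < d) :
    algebraMap k[X] F X ^ Fintype.card k ^ j ≠ algebraMap k[X] F X := by
  intro h
  have hq : 1 < Fintype.card k := Fintype.one_lt_card
  have hcomp : (((FiniteField.frobeniusAlgHom k F) ^ j : F →ₐ[k] F)).comp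
      (IsScalarTower.toAlgHom k k[X] F) = IsScalarTower.toAlgHom k k[X] F := by
    refine Polynomial.algHom_ext ?_
    simpa [iterate_frobeniusAlgHom] using h
  have hall : ∀ x : F, x ^ Fintype.card k ^ j = x := by
    intro x
    obtain ⟨a, rfl⟩ := hsurj x
    simpa [iterate_frobeniusAlgHom] using DFunLike.congr_fun hcomp a
  have hne : (X ^ Fintype.card k ^ j - X : F[X]) ≠ 0 :=
    FiniteField.X_pow_card_pow_sub_X_ne_zero F hj hq
  have hle : Fintype.card F ≤ Fintype.card k ^ j := by
    classical
    rw [← FiniteField.X_pow_card_pow_sub_X_natDegree_eq F hj hq]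
    refine (Finset.card_le_card (s := Finset.univ) (t := (X ^ Fintype.card k ^ j - X : F[X]).roots.toFinset) ?_).trans
      ((Multiset.toFinset_card_le _).trans (card_roots' _))
    intro x _
    simp [hne, hall x]
  rw [hd] at hle
  exact absurd hle (not_le.2 (Nat.pow_lt_pow_right hq hjd))

/-- For q = 2 the number BC_1 is -e_1 = -1/(t² - t), and d > 1 keeps the denominator nonzero. This
is the exceptional case of the local criterion. -/
theorem BC_one_ne_zero [Fintype F] (hsurj : Function.Surjective (algebraMap k[X] F))
    {d : ℕ} (hd : Fintype.card F = Fintype.card k ^ d) (h1 : 1 < d) (hk : Fintype.card k = 2) :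
    BC k F 1 ≠ 0 := by
  have hX := algebraMap_X_pow_card_pow_ne hsurj hd one_ne_zero h1
  have hc : ∀ i, PowerSeries.coeff i (PowerSeries.mk (BC k F)) = BC k F i := fun i =>
    PowerSeries.coeff_mk _ _
  have e0 : PowerSeries.coeff 0 (exp k F) = 0 := coeff_exp_of_ne k F 0 fun i => by
    rw [hk]; positivity
  have e1 : PowerSeries.coeff 1 (exp k F) = 1 := by simpa [expCoeff_zero] using coeff_exp_pow k F 0
  have e2 : PowerSeries.coeff 2 (exp k F) = expCoeff k F 1 := by
    have := coeff_exp_pow k F 1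
    rwa [pow_one, hk] at this
  have H1 := congrArg (PowerSeries.coeff 1) (mk_BC_mul_exp k F)
  have H2 := congrArg (PowerSeries.coeff 2) (mk_BC_mul_exp k F)
  rw [PowerSeries.coeff_mul, PowerSeries.coeff_X] at H1 H2
  simp [Finset.Nat.antidiagonal_succ, hc, e0, e1, e2] at H1 H2
  intro h
  rw [h, H1, expCoeff, expCoeff_zero] at H2
  simp only [zero_add, one_pow, one_mul, add_zero] at H2 hX
  exact one_div_ne_zero (sub_ne_zero.2 hX) H2

end ResidueField

/-! ### Orthogonality of the characters of F^× -/

section PowerSums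

variable {F : Type*} [Field F] [Fintype F] [DecidableEq F]

theorem sum_units_inv_pow_mul_pow_eq {n m : ℕ} (hn : n ≤ Fintype.card F - 1) :
    ∑ a : Fˣ, ((a⁻¹ : Fˣ) : F) ^ n * (a : F) ^ m =
      if Fintype.card F - 1 ∣ m + (Fintype.card F - 1 - n) then -1 else 0 := by
  rw [← FiniteField.sum_pow_units]
  refine Finset.sum_congr rfl fun a _ => ?_
  have h1 : (a : F) ^ n * (a : F) ^ (Fintype.card F - 1 - n) = 1 := by
    rw [← pow_add, Nat.add_sub_cancel' hn]
    exact FiniteField.pow_card_sub_one_eq_one _ a.ne_zero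
  have h2 : ((a⁻¹ : Fˣ) : F) ^ n * (a : F) ^ n = 1 := by
    rw [← mul_pow, Units.inv_mul, one_pow]
  rw [pow_add]
  linear_combination ((a : F) ^ m * (a : F) ^ (Fintype.card F - 1 - n)) * h2 -
    ((a⁻¹ : Fˣ) : F) ^ n * (a : F) ^ m * h1

theorem dvd_add_sub_iff {N n m : ℕ} (hn : n ≤ N) (h1 : m + (N - n) < 2 * N)
    (h2 : 0 < m + (N - n)) : N ∣ m + (N - n) ↔ m = n := by
  constructor
  · rintro ⟨c, hc⟩
    rcases c with _ | _ | c
    · omega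
    · omega
    · rw [mul_add, mul_add] at hc
      omega
  · rintro rfl
    rw [Nat.add_sub_cancel' hn]

/-- The exponents 0 and Q-1 give the same character, but the bounds on n exclude it; so m may run
over every exponent below Q. -/
theorem sum_units_inv_pow_mul_pow {n m : ℕ} (hn : 1 ≤ n)
    (hn' : n < Fintype.card F - 1) (hm : m < Fintype.card F) :
    ∑ a : Fˣ, ((a⁻¹ : Fˣ) : F) ^ n * (a : F) ^ m = if m = n then -1 else 0 := by
  rw [sum_units_inv_pow_mul_pow_eq hn'.le]
  exact if_congr (dvd_add_sub_iff hn'.le (by omega) (by omega)) rfl rfl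

end PowerSums

/-! ### The logarithmic derivative in F[z]/(z^Q) -/

section LocalCriterion

variable {k F : Type*} [Field k] [Fintype k] [Field F] [Algebra k F] [Algebra k[X] F]
  [IsScalarTower k k[X] F] {B : Type*} [CommRing B] [Algebra F B]

theorem coeff_eq_of_aeval_eq {z : B} {Q : ℕ}
    (hker : ∀ p : F[X], aeval z p = 0 → X ^ Q ∣ p) {p r : F[X]} (h : aeval z p = aeval z r)
    {m : ℕ} (hm : m < Q) : p.coeff m = r.coeff m := by
  have := X_pow_dvd_iff.1 (hker (p - r) (by rw [map_sub, h, sub_self])) m hm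
  rwa [coeff_sub, sub_eq_zero] at this

theorem aeval_smul_eq (z : B) (c : F) (p : F[X]) : aeval (c • z) p = aeval z (p.comp (C c * X)) := by
  rw [aeval_comp, map_mul, aeval_C, aeval_X, Algebra.smul_def]

variable [Fintype F] [DecidableEq F]

/-- The twisted sum `∑_a a⁻ⁿ dlog(u_a)` of logarithmic derivatives of a family of units. -/
noncomputable def twistedDlog (D : Derivation F B B) (u : Fˣ → Bˣ) (n : ℕ) : B :=
  ∑ a : Fˣ, (((a⁻¹ : Fˣ) : F) ^ n) • (((u a)⁻¹ : Bˣ) * D (u a))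

/-- The substitution z ↦ az multiplies dz by a, so the differential (twisted sum)·dz lies in the
a^n-eigenspace. The extra factor a on the left comes from dz. -/
theorem smul_twistedDlog {z : B} (hsurj : Function.Surjective (aeval z : F[X] →ₐ[F] B))
    (D : Derivation F B B) (hD : D z = 1)
    (γ : Fˣ → B →ₐ[F] B) (hγ : ∀ a, γ a z = (a : F) • z)
    (u : Fˣ → Bˣ) (hcoc : ∀ a b, (u (a * b) : B) = γ a (u b) * u a)
    {n : ℕ} (hn : 1 ≤ n) (hn' : n < Fintype.card F - 1) (a : Fˣ) :
    (a : F) • γ a (twistedDlog D u n) = (a : F) ^ n • twistedDlog D u n := by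
  have hDγ : ∀ x, D (γ a x) = (a : F) • γ a (D x) := by
    intro x
    obtain ⟨p, rfl⟩ := hsurj x
    rw [← aeval_algHom_apply, Derivation.map_aeval, Derivation.map_aeval, hγ, hD, D.map_smul, hD, smul_eq_mul, smul_eq_mul,
      mul_one, mul_smul_comm, mul_one, ← aeval_algHom_apply, hγ]
  have hlog : ∀ b, (a : F) • γ a (((u b)⁻¹ : Bˣ) * D (u b)) =
      ((u (a * b))⁻¹ : Bˣ) * D (u (a * b)) - ((u a)⁻¹ : Bˣ) * D (u a) := by
    intro b
    have h1 : γ a (((u b)⁻¹ : Bˣ) : B) * γ a (u b) = 1 := by rw [← map_mul, Units.inv_mul, map_one]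
    have h2 := (u a).inv_mul
    have h3 : (((u (a * b))⁻¹ : Bˣ) : B) = γ a (((u b)⁻¹ : Bˣ) : B) * ((u a)⁻¹ : Bˣ) := by
      rw [Units.inv_eq_of_mul_eq_one_right]
      rw [hcoc]
      linear_combination (γ a (((u b)⁻¹ : Bˣ) : B) * γ a (u b)) * h2 + h1
    rw [h3, hcoc, Derivation.leibniz, hDγ, map_mul, smul_eq_mul, smul_eq_mul, Algebra.smul_def, Algebra.smul_def]
    linear_combination (-((u a)⁻¹ : Bˣ) * D (u a)) * h1 - (algebraMap F B a * γ a (((u b)⁻¹ : Bˣ) : B) * γ a (D (u b))) * h2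
  have hsum := sum_units_inv_pow_mul_pow (F := F) (m := 0) hn hn' (by omega)
  simp only [pow_zero, mul_one] at hsum
  rw [if_neg (by omega)] at hsum
  rw [twistedDlog, map_sum, Finset.smul_sum]
  -- The correction term dlog u_a from the cocycle relation does not depend on b, so the vanishing
  -- of ∑ b^(-n) removes it.
  simp only [map_smul, smul_comm (a : F) (_ : F), hlog, smul_sub, Finset.sum_sub_distrib, ← Finset.sum_smul, hsum, zero_smul, sub_zero]
  rw [← Equiv.sum_comp (Equiv.mulLeft a) fun b : Fˣ => (((b⁻¹ : Fˣ) : F) ^ n) • ((((u b)⁻¹ : Bˣ) : B) * D (u b)), Finset.smul_sum]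
  refine Finset.sum_congr rfl fun b _ => ?_
  rw [Equiv.coe_mulLeft, smul_smul, mul_inv, Units.val_mul, mul_pow, ← mul_assoc, ← mul_pow, Units.mul_inv, one_pow, one_mul]

/-- Since u_a = e(az)/e(z) and e' = 1, the generating series of the numbers BC_m appears in dlog
u_a, and the twisted sum selects its n-th term. The power z² clears the denominators, as z and e(z)
are zero divisors. -/
theorem mul_twistedDlog {d : ℕ} (hd : Fintype.card F = Fintype.card k ^ d) {z : B} (hz : z ^ Fintype.card F = 0)
    (D : Derivation F B B) (hD : D z = 1) (u : Fˣ → Bˣ)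
    (hu : ∀ a : Fˣ, (u a : B) * aeval z (expTrunc k F d) = aeval ((a : F) • z) (expTrunc k F d))
    {n : ℕ} (hn : 1 ≤ n) (hn' : n < Fintype.card F - 1) :
    z ^ 2 * twistedDlog D u n = - BC k F n • z ^ (n + 1) := by
  have hd0 : d ≠ 0 := by
    rintro rfl
    rw [pow_zero] at hd
    omega
  set lam := aeval z (expTrunc k F d) with hlam
  set β : F → B := fun c => aeval (c • z) (PowerSeries.trunc (Fintype.card k ^ d)
    (PowerSeries.mk (BC k F))) with hβ
  have hβe : ∀ c : F, β c * aeval (c • z) (expTrunc k F d) = c • z := by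
    intro c
    obtain ⟨r, hr⟩ := X_pow_dvd_trunc_BC_mul_expTrunc k F d
    have := congrArg (aeval (c • z)) hr
    rw [map_sub, map_mul, map_mul, map_pow, aeval_X, ← hd, _root_.smul_pow, hz, smul_zero, zero_mul,
      sub_eq_zero, hd] at this
    exact this
  have hDe : ∀ c : F, D (aeval (c • z) (expTrunc k F d)) = algebraMap F B c := by
    intro c
    rw [aeval_smul_eq, Derivation.map_aeval, derivative_expTrunc_comp k F d hd0, hD, aeval_C,
      smul_eq_mul, mul_one]
  have hDlam : D lam = 1 := by rw [hlam, ← one_smul F z, hDe, map_one]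
  have hβlam : β 1 * lam = z := by simpa using hβe 1
  -- This is dlog u_a = a/e(az) - 1/e(z) multiplied by z·e(z), with `β a` playing the role of
  -- az/e(az).
  have hlog : ∀ a : Fˣ, z * lam * (((u a)⁻¹ : Bˣ) * D (u a)) = lam * β a - z := by
    intro a
    have h1 := hDe a
    rw [← hu, Derivation.leibniz, hDlam, smul_eq_mul, smul_eq_mul, mul_one] at h1
    have h2 := hβe a
    rw [← hu, Algebra.smul_def] at h2
    have h3 := (u a).inv_mul
    linear_combination (z * ((u a)⁻¹ : Bˣ)) * h1 - (((u a)⁻¹ : Bˣ) : B) * h2 - (z - lam * β a) * h3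
  have hβsum : ∀ a : Fˣ, β a = ∑ m ∈ Finset.range (Fintype.card F), (BC k F m * (a : F) ^ m) • z ^ m := by
    intro a
    change aeval _ _ = _
    rw [aeval_eq_sum_range' (n := Fintype.card F)]
    · refine Finset.sum_congr rfl fun m hm => ?_
      rw [PowerSeries.coeff_trunc, if_pos (by rw [← hd]; exact Finset.mem_range.1 hm), PowerSeries.coeff_mk, _root_.smul_pow, smul_smul]
    · obtain ⟨Q, hQ⟩ := Nat.exists_eq_succ_of_ne_zero (show Fintype.card F ≠ 0 by omega)
      rw [← hd, hQ]
      exact PowerSeries.natDegree_trunc_lt _ _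
  have hsum0 := sum_units_inv_pow_mul_pow (F := F) (m := 0) hn hn' (by omega)
  simp only [pow_zero, mul_one] at hsum0
  rw [if_neg (by omega)] at hsum0
  have hβtot : ∑ a : Fˣ, (((a⁻¹ : Fˣ) : F) ^ n) • β a = - BC k F n • z ^ n := by
    simp only [hβsum, Finset.smul_sum]
    rw [Finset.sum_comm, Finset.sum_eq_single_of_mem n (Finset.mem_range.2 (by omega))]
    · simp only [smul_smul]
      rw [← Finset.sum_smul]
      have := sum_units_inv_pow_mul_pow (F := F) (m := n) hn hn' (by omega)
      rw [if_pos rfl] at this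
      congr 1
      calc _ = BC k F n * ∑ a : Fˣ, ((a⁻¹ : Fˣ) : F) ^ n * (a : F) ^ n := by
            rw [Finset.mul_sum]; exact Finset.sum_congr rfl fun a _ => by ring
        _ = _ := by rw [this]; ring
    · intro m hm hmn
      simp only [smul_smul]
      rw [← Finset.sum_smul]
      have := sum_units_inv_pow_mul_pow (F := F) (m := m) hn hn' (Finset.mem_range.1 hm)
      rw [if_neg hmn] at this
      convert zero_smul F (z ^ m)
      calc _ = BC k F m * ∑ a : Fˣ, ((a⁻¹ : Fˣ) : F) ^ n * (a : F) ^ m := by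
            rw [Finset.mul_sum]; exact Finset.sum_congr rfl fun a _ => by ring
        _ = _ := by rw [this, mul_zero]
  have key : z * lam * twistedDlog D u n = lam * (- BC k F n • z ^ n) := by
    rw [twistedDlog, Finset.mul_sum, ← hβtot]
    simp only [mul_smul_comm, hlog, smul_sub, Finset.sum_sub_distrib, ← Finset.sum_smul, hsum0, zero_smul, sub_zero, Finset.mul_sum]
  -- As `β 1 * lam = z`, this replaces the factor `lam` on each side by z.
  have := congrArg (β 1 * ·) key
  simp only [Algebra.smul_def] at this ⊢
  linear_combination this + (algebraMap F B (- BC k F n) * z ^ n - z * twistedDlog D u n) * hβlam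

/-- Constants c in k^× do not change dlog, so reindexing by c multiplies the sum by c; when q ≠ 2
some c differs from 1. -/
theorem twistedDlog_one_eq_zero (D : Derivation F B B) (u : Fˣ → Bˣ)
    (hk : ∀ c a : Fˣ, (c : F) ∈ (algebraMap k F).range → (u (c * a) : B) = (c : F) • (u a : B))
    (h2 : Fintype.card k ≠ 2) : twistedDlog D u 1 = 0 := by
  obtain ⟨c, hc0, hc1⟩ : ∃ c : k, c ≠ 0 ∧ c ≠ 1 := by
    classical
    have hq : 1 < Fintype.card k := Fintype.one_lt_card
    have : ({0, 1} : Finset k).card < (Finset.univ : Finset k).card :=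
      (Finset.card_le_two).trans_lt (by rw [Finset.card_univ]; omega)
    obtain ⟨c, -, hc⟩ := Finset.exists_mem_notMem_of_card_lt_card this
    simp only [Finset.mem_insert, Finset.mem_singleton, not_or] at hc
    exact ⟨c, hc⟩
  let c' : Fˣ := Units.mk0 (algebraMap k F c) ((_root_.map_ne_zero _).2 hc0)
  have hlog : ∀ a, ((((u (c' * a))⁻¹ : Bˣ) : B) * D (u (c' * a))) =
      ((((u a)⁻¹ : Bˣ) : B) * D (u a)) := by
    intro a
    have h := hk c' a ⟨c, rfl⟩
    have h3 := (u a).inv_mul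
    have h4 := (u (c' * a)).inv_mul
    rw [h, Derivation.map_smul]
    rw [h] at h4
    rw [Algebra.smul_def] at h4 ⊢
    linear_combination (-(((u (c' * a))⁻¹ : Bˣ) : B) * algebraMap F B c' * D (u a)) * h3 + ((((u a)⁻¹ : Bˣ) : B) * D (u a)) * h4
  have hfix : (c' : F) • twistedDlog D u 1 = twistedDlog D u 1 := by
    conv_lhs => rw [twistedDlog, ← Equiv.sum_comp (Equiv.mulLeft c'), Finset.smul_sum]
    refine Finset.sum_congr rfl fun b _ => ?_
    rw [Equiv.coe_mulLeft, hlog, smul_smul, mul_inv, Units.val_mul, mul_pow, ← mul_assoc, pow_one, pow_one, Units.mul_inv, one_mul]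
  have hne : (c' : F) - 1 ≠ 0 := by
    rw [sub_ne_zero, Units.val_mk0]
    exact fun h => hc1 ((algebraMap k F).injective (h.trans (map_one _).symm))
  have := sub_eq_zero.2 hfix
  nth_rewrite 2 [← one_smul F (twistedDlog D u 1)] at this
  rw [← sub_smul] at this
  rw [← inv_smul_smul₀ hne (twistedDlog D u 1), this, smul_zero]

/-- The product with z² determines the coefficient of z^(n-1) as -BC_n. By equivariance a nonzero
coefficient of z^m requires m + 1 ≡ n modulo Q-1. For n > 1 this leaves only m = n-1. For n = 1 the
exponent m = Q-1 is possible too: if q ≠ 2 the whole sum vanishes, and if q = 2 then BC_1 is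
nonzero. -/
theorem twistedDlog_eq_zero_iff (hA : Function.Surjective (algebraMap k[X] F))
    {d : ℕ} (hd : Fintype.card F = Fintype.card k ^ d) {z : B}
    (hsurj : Function.Surjective (aeval z : F[X] →ₐ[F] B))
    (hz : z ^ Fintype.card F = 0)
    (hker : ∀ p : F[X], aeval z p = 0 → X ^ Fintype.card F ∣ p)
    (D : Derivation F B B) (hD : D z = 1)
    (γ : Fˣ → B →ₐ[F] B) (hγ : ∀ a, γ a z = (a : F) • z)
    (u : Fˣ → Bˣ) (hcoc : ∀ a b, (u (a * b) : B) = γ a (u b) * u a)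
    (hu : ∀ a : Fˣ, (u a : B) * aeval z (expTrunc k F d) = aeval ((a : F) • z) (expTrunc k F d))
    (hk : ∀ c a : Fˣ, (c : F) ∈ (algebraMap k F).range → (u (c * a) : B) = (c : F) • (u a : B))
    {n : ℕ} (hn : 1 ≤ n) (hn' : n < Fintype.card F - 1) :
    twistedDlog D u n = 0 ↔ BC k F n = 0 := by
  obtain ⟨p, hp⟩ := hsurj (twistedDlog D u n)
  have hmul := mul_twistedDlog hd hz D hD u hu hn hn'
  have hcoeff : p.coeff (n - 1) = - BC k F n := by
    have h : aeval z (X ^ 2 * p) = aeval z (C (- BC k F n) * X ^ (n + 1)) := by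
      rw [map_mul, hp, map_pow, aeval_X, hmul, map_mul, aeval_C, map_pow, aeval_X, Algebra.smul_def]
    have := coeff_eq_of_aeval_eq hker h (m := n + 1) (by omega)
    rw [coeff_C_mul_X_pow, if_pos rfl, show n + 1 = (n - 1) + 2 by omega, coeff_X_pow_mul] at this
    exact this
  constructor
  · intro h
    rw [h] at hp
    have := coeff_eq_of_aeval_eq hker (hp.trans (map_zero (aeval z)).symm) (m := n - 1) (by omega)
    rw [hcoeff, coeff_zero, neg_eq_zero] at this
    exact this
  · intro h
    by_cases h1 : n = 1
    · subst h1
      by_cases h2 : Fintype.card k = 2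
      · refine absurd h (BC_one_ne_zero hA hd ?_ h2)
        rw [h2] at hd
        rcases d with _ | _ | d
        · omega
        · omega
        · omega
      · exact twistedDlog_one_eq_zero D u hk h2
    · rw [← hp]
      have hdvd : X ^ Fintype.card F ∣ p := by
        rw [X_pow_dvd_iff]
        intro m hm
        by_contra hne
        have hpow : ∀ a : Fˣ, a ^ (m + 1 + (Fintype.card F - 1 - n)) = 1 := by
          intro a
          have h3 := smul_twistedDlog hsurj D hD γ hγ u hcoc hn hn' a
          rw [← hp, ← aeval_algHom_apply, hγ, aeval_smul_eq, ← map_smul, ← map_smul] at h3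
          have h4 := coeff_eq_of_aeval_eq hker h3 hm
          rw [coeff_smul, coeff_smul, comp_C_mul_X_coeff, smul_eq_mul, smul_eq_mul] at h4
          have h5 : (a : F) ^ (m + 1) = (a : F) ^ n := mul_right_cancel₀ hne (by rw [← h4]; ring)
          refine Units.ext ?_
          rw [Units.val_pow_eq_pow_val, pow_add, h5, ← pow_add, Nat.add_sub_cancel' hn'.le, Units.val_one]
          exact FiniteField.pow_card_sub_one_eq_one _ a.ne_zero
        rw [FiniteField.forall_pow_eq_one_iff] at hpow
        obtain ⟨c, hc⟩ := hpow
        have hmn : m = n - 1 := by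
          rcases c with _ | _ | c
          · omega
          · omega
          · rw [mul_add, mul_add] at hc
            omega
        rw [hmn, hcoeff, h, neg_zero] at hne
        exact hne rfl
      obtain ⟨r, rfl⟩ := hdvd
      rw [map_mul, map_pow, aeval_X, hz, zero_mul]

end LocalCriterion

end Carlitz

namespace Carlitz

/-! ### Reduction of BC_n modulo 𝔭 -/

section Reduction

variable (k K F : Type*) [Field k] [Field K] [Algebra k[X] K] [FaithfulSMul k[X] K]
  [Field F] [Algebra k[X] F]

/-- The graph in `K × F` of the reduction map from the local ring of `k[X]` at the kernel of
`k[X] → F` to `F`. -/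
def reductionGraph : Subring (K × F) where
  carrier := {x | ∃ a b : k[X], algebraMap k[X] F b ≠ 0 ∧
    algebraMap k[X] K b * x.1 = algebraMap k[X] K a ∧
    algebraMap k[X] F b * x.2 = algebraMap k[X] F a}
  mul_mem' := by
    rintro x y ⟨a, b, hb, h1, h2⟩ ⟨a', b', hb', h1', h2'⟩
    refine ⟨a * a', b * b', by rw [map_mul]; exact mul_ne_zero hb hb', ?_, ?_⟩
    · rw [map_mul, map_mul, ← h1, ← h1', Prod.fst_mul]; ring
    · rw [map_mul, map_mul, ← h2, ← h2', Prod.snd_mul]; ring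
  one_mem' := ⟨1, 1, by simp, by simp, by simp⟩
  add_mem' := by
    rintro x y ⟨a, b, hb, h1, h2⟩ ⟨a', b', hb', h1', h2'⟩
    refine ⟨b' * a + b * a', b * b', by rw [map_mul]; exact mul_ne_zero hb hb', ?_, ?_⟩
    · rw [map_mul, map_add, map_mul, map_mul, ← h1, ← h1', Prod.fst_add]; ring
    · rw [map_mul, map_add, map_mul, map_mul, ← h2, ← h2', Prod.snd_add]; ring
  zero_mem' := ⟨0, 1, by simp, by simp, by simp⟩
  neg_mem' := by
    rintro x ⟨a, b, hb, h1, h2⟩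
    exact ⟨-a, b, hb, by rw [Prod.fst_neg, map_neg, ← h1, mul_neg],
      by rw [Prod.snd_neg, map_neg, ← h2, mul_neg]⟩

variable {k K F}

theorem inv_mem_reductionGraph {x : K} {y : F} (h : (x, y) ∈ reductionGraph k K F) (hy : y ≠ 0) :
    (x⁻¹, y⁻¹) ∈ reductionGraph k K F := by
  obtain ⟨a, b, hb, h1, h2⟩ := h
  have ha : algebraMap k[X] F a ≠ 0 := by rw [← h2]; exact mul_ne_zero hb hy
  have ha' : algebraMap k[X] K a ≠ 0 := by
    rw [Ne, FaithfulSMul.algebraMap_eq_zero_iff]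
    rintro rfl
    exact ha (map_zero _)
  have hx : x ≠ 0 := by
    rintro rfl
    rw [mul_zero] at h1
    exact ha' h1.symm
  refine ⟨b, a, ha, ?_, ?_⟩
  · rw [← h1, mul_inv_cancel_right₀ hx]
  · rw [← h2, mul_inv_cancel_right₀ hy]

theorem algebraMap_mem_reductionGraph (a : k[X]) :
    (algebraMap k[X] K a, algebraMap k[X] F a) ∈ reductionGraph k K F :=
  ⟨a, 1, by simp, by simp, by simp⟩

variable [Fintype k] [Algebra k F] [IsScalarTower k k[X] F] [Fintype F]
  (hsurj : Function.Surjective (algebraMap k[X] F)) {d : ℕ}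
  (hd : Fintype.card F = Fintype.card k ^ d)

include hsurj hd

theorem expCoeff_mem_reductionGraph {i : ℕ} (hi : i < d) :
    (expCoeff k K i, expCoeff k F i) ∈ reductionGraph k K F := by
  induction i with
  | zero => exact one_mem _
  | succ i ih =>
    have h1 := inv_mem_reductionGraph (algebraMap_mem_reductionGraph (K := K) (F := F)
      (X ^ Fintype.card k ^ (i + 1) - X)) (by
        rw [map_sub, map_pow]
        exact sub_ne_zero.2 (algebraMap_X_pow_card_pow_ne hsurj hd (Nat.succ_ne_zero i) hi))
    have h2 := mul_mem (pow_mem (ih (by omega)) (Fintype.card k)) h1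
    rw [map_sub, map_pow, map_sub, map_pow] at h2
    rw [expCoeff, expCoeff, div_eq_mul_inv, div_eq_mul_inv]
    exact h2

theorem coeff_exp_mem_reductionGraph {j : ℕ} (hj : j < Fintype.card F) :
    (PowerSeries.coeff j (exp k K), PowerSeries.coeff j (exp k F)) ∈ reductionGraph k K F := by
  by_cases h : ∃ i, j = Fintype.card k ^ i
  · obtain ⟨i, rfl⟩ := h
    rw [coeff_exp_pow, coeff_exp_pow]
    rw [hd] at hj
    exact expCoeff_mem_reductionGraph hsurj hd
      ((Nat.pow_lt_pow_iff_right Fintype.one_lt_card).1 hj)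
  · rw [not_exists] at h
    rw [coeff_exp_of_ne k K j h, coeff_exp_of_ne k F j h]
    exact zero_mem _

omit hsurj hd [FaithfulSMul k[X] K] [Algebra k F] [IsScalarTower k k[X] F] [Fintype F] in
-- This recursion has no denominators other than those in the exponential, so integrality and
-- reduction pass from the e_i to the BC_n.
theorem BC_eq_sub_sum (n : ℕ) : BC k K n = (if n = 0 then 1 else 0) -
    ∑ i ∈ Finset.range n, BC k K i * PowerSeries.coeff (n + 1 - i) (exp k K) := by
  have h0 : PowerSeries.coeff 0 (exp k K) = 0 :=
    coeff_exp_of_ne k K 0 fun i => (pow_pos Fintype.card_pos i).ne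
  have h1 : PowerSeries.coeff 1 (exp k K) = 1 := by
    simpa [expCoeff_zero] using coeff_exp_pow k K 0
  have h := congrArg (PowerSeries.coeff (n + 1)) (mk_BC_mul_exp k K)
  rw [PowerSeries.coeff_mul, PowerSeries.coeff_X, Finset.Nat.sum_antidiagonal_eq_sum_range_succ_mk,
    Finset.sum_range_succ, Finset.sum_range_succ] at h
  simp only [PowerSeries.coeff_mk, Nat.add_sub_cancel_left, h1, Nat.sub_self, h0, mul_one, mul_zero,
    add_zero, Nat.add_eq_right] at h
  rw [← h]
  ring

/-- The recursion involves coefficients of the exponential of index at most n + 1 < Q, which precede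
the first one with a denominator divisible by 𝔭. -/
theorem BC_mem_reductionGraph {n : ℕ} (hn : n < Fintype.card F - 1) :
    (BC k K n, BC k F n) ∈ reductionGraph k K F := by
  induction n using Nat.strong_induction_on with
  | _ n ih =>
    have h : (BC k K n, BC k F n) = (if n = 0 then 1 else 0) -
        ∑ i ∈ Finset.range n, (BC k K i, BC k F i) *
          (PowerSeries.coeff (n + 1 - i) (exp k K), PowerSeries.coeff (n + 1 - i) (exp k F)) := by
      ext
      · rw [Prod.fst_sub, Prod.fst_sum]
        refine (BC_eq_sub_sum n).trans ?_
        split_ifs <;> rfl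
      · rw [Prod.snd_sub, Prod.snd_sum]
        refine (BC_eq_sub_sum n).trans ?_
        split_ifs <;> rfl
    rw [h]
    refine sub_mem (by split_ifs <;> [exact one_mem _; exact zero_mem _]) (sum_mem fun i hi => ?_)
    rw [Finset.mem_range] at hi
    exact mul_mem (ih i hi (by omega)) (coeff_exp_mem_reductionGraph hsurj hd (by omega))

omit [FaithfulSMul k[X] K] in
theorem valuation_BC_lt_one_iff [IsFractionRing k[X] K] (𝔭 : HeightOneSpectrum k[X])
    (hker : ∀ a, algebraMap k[X] F a = 0 ↔ a ∈ 𝔭.asIdeal) {n : ℕ} (hn : n < Fintype.card F - 1) :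
    𝔭.valuation K (BC k K n) < 1 ↔ BC k F n = 0 := by
  obtain ⟨a, b, hb, h1, h2⟩ := BC_mem_reductionGraph (K := K) hsurj hd hn
  have hvb : 𝔭.valuation K (algebraMap k[X] K b) = 1 := by
    refine le_antisymm (𝔭.valuation_le_one b) (not_lt.1 fun h => hb ?_)
    rwa [hker, ← 𝔭.valuation_lt_one_iff_mem (K := K)]
  have hv := congrArg (𝔭.valuation K) h1
  rw [map_mul, hvb, one_mul] at hv
  simp only at hv h2
  rw [hv, 𝔭.valuation_lt_one_iff_mem, ← hker, ← h2, mul_eq_zero, or_iff_right hb]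

end Reduction

/-! ### The truncated exponential on nilpotent elements -/

section ExponentialMap

variable {k F : Type*} [Field k] [Fintype k] [Field F] [Algebra k F] [Algebra k[X] F]
  [IsScalarTower k k[X] F] {B : Type*} [CommRing B] [Algebra F B] [Algebra k B]
  [IsScalarTower k F B]

variable (k F B) in
/-- The truncated Carlitz exponential as a `k`-linear endomorphism of an `F`-algebra. -/
noncomputable def expMap (d : ℕ) : B →ₗ[k] B :=
  ∑ i ∈ Finset.range d, LinearMap.mulLeft k (algebraMap F B (expCoeff k F i)) ∘ₗ
    ((FiniteField.frobeniusAlgHom k B) ^ i).toLinearMap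

theorem expMap_eq_sum (d : ℕ) (x : B) : expMap k F B d x =
    ∑ i ∈ Finset.range d, algebraMap F B (expCoeff k F i) * x ^ Fintype.card k ^ i := by
  simp [expMap, iterate_frobeniusAlgHom]

theorem expMap_apply (d : ℕ) (x : B) : expMap k F B d x = aeval x (expTrunc k F d) := by
  rw [expMap_eq_sum, expTrunc, map_sum]
  simp

variable [Fintype F] {d : ℕ} (hd : Fintype.card F = Fintype.card k ^ d)

include hd

theorem trunc_BC_mul_expMap {x : B} (hx : x ^ Fintype.card F = 0) :
    aeval x (PowerSeries.trunc (Fintype.card k ^ d) (PowerSeries.mk (BC k F))) *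
      expMap k F B d x = x := by
  obtain ⟨r, hr⟩ := X_pow_dvd_trunc_BC_mul_expTrunc k F d
  have := congrArg (aeval x) hr
  rw [map_sub, map_mul, map_mul, map_pow, aeval_X, ← hd, hx, zero_mul, sub_eq_zero, hd] at this
  rw [expMap_apply, this]

theorem pow_card_sub {x y : B} : (x - y) ^ Fintype.card F = x ^ Fintype.card F - y ^ Fintype.card F := by
  rw [hd, ← iterate_frobeniusAlgHom, ← iterate_frobeniusAlgHom, ← iterate_frobeniusAlgHom,
    ← AlgHom.coe_pow, map_sub]

/-- The map is additive, and the truncation of z/e(z) recovers a nilpotent argument as a multiple of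
its image. -/
theorem expMap_injOn {x y : B} (hx : x ^ Fintype.card F = 0) (hy : y ^ Fintype.card F = 0)
    (h : expMap k F B d x = expMap k F B d y) : x = y := by
  have h1 : (x - y) ^ Fintype.card F = 0 := by rw [pow_card_sub hd, hx, hy, sub_zero]
  rw [← sub_eq_zero, ← trunc_BC_mul_expMap hd h1, map_sub, h, sub_self, mul_zero]

/-- Injectivity on the finite ideal (x) gives surjectivity, so a logarithm of x exists without
writing its series. It generates the same ideal as x. -/
theorem exists_expMap_eq [Finite B] {x : B} (hx : x ^ Fintype.card F = 0) :
    ∃ z : B, x ∣ z ∧ z ∣ x ∧ z ^ Fintype.card F = 0 ∧ expMap k F B d z = x := by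
  have hdvd : ∀ y : B, y ∣ expMap k F B d y := fun y => by
    rw [expMap_eq_sum]
    exact Finset.dvd_sum fun i _ => Dvd.dvd.mul_left
      (dvd_pow_self _ (pow_ne_zero _ Fintype.card_ne_zero)) _
  have hnil : ∀ y ∈ Ideal.span {x}, y ^ Fintype.card F = 0 := by
    intro y hy
    obtain ⟨c, rfl⟩ := Ideal.mem_span_singleton.1 hy
    rw [mul_pow, hx, zero_mul]
  let f : Ideal.span {x} → Ideal.span {x} := fun y => ⟨expMap k F B d y,
    Ideal.mem_of_dvd _ (hdvd y) y.2⟩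
  have hf : Function.Injective f := fun y y' h =>
    Subtype.ext (expMap_injOn hd (hnil y y.2) (hnil y' y'.2) (congrArg Subtype.val h))
  obtain ⟨z, hz⟩ := Finite.surjective_of_injective hf ⟨x, Ideal.mem_span_singleton_self x⟩
  have hz' : expMap k F B d z = x := congrArg Subtype.val hz
  exact ⟨z, Ideal.mem_span_singleton.1 z.2, (hdvd z).trans (dvd_of_eq hz'), hnil z z.2, hz'⟩

/-- The functional equation survives truncation: the only extra term of e(z)^q is a multiple of
z^(q^d), which is zero. -/
theorem expMap_smul_algebraMap_X (hsurj : Function.Surjective (algebraMap k[X] F))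
    {z : B} (hz : z ^ Fintype.card F = 0) :
    expMap k F B d (algebraMap k[X] F X • z) =
      algebraMap k[X] F X • expMap k F B d z + expMap k F B d z ^ Fintype.card k := by
  have hd0 : d ≠ 0 := by
    rintro rfl
    rw [pow_zero] at hd
    exact absurd hd Fintype.one_lt_card.ne'
  obtain ⟨d, rfl⟩ := Nat.exists_eq_succ_of_ne_zero hd0
  have hfrob : expMap k F B (d + 1) z ^ Fintype.card k = ∑ i ∈ Finset.range (d + 1),
      algebraMap F B (expCoeff k F i ^ Fintype.card k) * z ^ Fintype.card k ^ (i + 1) := by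
    rw [← FiniteField.frobeniusAlgHom_apply k, expMap_eq_sum, map_sum]
    refine Finset.sum_congr rfl fun i _ => ?_
    rw [FiniteField.frobeniusAlgHom_apply, mul_pow, map_pow, ← pow_mul, pow_succ]
  rw [hfrob, Finset.sum_range_succ, ← hd, hz, mul_zero, add_zero, expMap_eq_sum, expMap_eq_sum,
    Finset.sum_range_succ', Finset.sum_range_succ', smul_add, add_right_comm, Finset.smul_sum, ← Finset.sum_add_distrib]
  congr 1
  · refine Finset.sum_congr rfl fun i hi => ?_
    have hne := sub_ne_zero.2 (algebraMap_X_pow_card_pow_ne hsurj hd (Nat.succ_ne_zero i)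
      (Nat.succ_lt_succ (Finset.mem_range.1 hi)))
    have h : expCoeff k F (i + 1) * (algebraMap k[X] F X ^ Fintype.card k ^ (i + 1)) =
        algebraMap k[X] F X * expCoeff k F (i + 1) + expCoeff k F i ^ Fintype.card k := by
      rw [expCoeff]
      field_simp
      ring
    have h' := congrArg (algebraMap F B) h
    rw [map_mul, map_add, map_mul] at h'
    rw [_root_.smul_pow, Algebra.smul_def, Algebra.smul_def]
    linear_combination z ^ Fintype.card k ^ (i + 1) * h'
  · simp [expCoeff_zero]

variable [Algebra k[X] B]

/-- Two structures meet here: φ uses the image of t in `B`, while scalars act through `F`. They need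
not agree on `B`, but `htz` says they agree on multiples of z, which suffices for φ(a)(e(z)) =
e(az). -/
theorem aeval_op_expMap (hsurj : Function.Surjective (algebraMap k[X] F))
    {z : B} (hz : z ^ Fintype.card F = 0)
    (htz : algebraMap k[X] B X * z = algebraMap k[X] F X • z) (a : k[X]) :
    aeval (op k B) a (expMap k F B d z) = expMap k F B d (algebraMap k[X] F a • z) := by
  induction a using Polynomial.induction_on with
  | C c =>
    rw [aeval_C, Module.algebraMap_end_apply, ← map_smul, ← algebraMap_eq, ← IsScalarTower.algebraMap_apply, algebraMap_smul]
  | add p r hp hr => rw [map_add, LinearMap.add_apply, hp, hr, map_add, add_smul, map_add]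
  | monomial n c ih =>
    have hXop : ∀ x : B, op k B x = algebraMap k[X] B X * x + x ^ Fintype.card k := fun _ => rfl
    have h1 : (C c * X ^ (n + 1) : k[X]) = X * (C c * X ^ n) := by ring
    have hz' : (algebraMap k[X] F (C c * X ^ n) • z) ^ Fintype.card F = 0 := by
      rw [_root_.smul_pow, hz, smul_zero]
    have hdvd : z ∣ expMap k F B d (algebraMap k[X] F (C c * X ^ n) • z) := by
      rw [expMap_eq_sum]
      refine Finset.dvd_sum fun i _ => Dvd.dvd.mul_left
        (Dvd.dvd.trans ?_ (dvd_pow_self _ (pow_ne_zero _ Fintype.card_ne_zero))) _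
      rw [Algebra.smul_def]
      exact dvd_mul_left _ _
    obtain ⟨y, hy⟩ := hdvd
    rw [h1, map_mul, aeval_X, Module.End.mul_apply, ih, (algebraMap k[X] F).map_mul X, mul_smul,
      expMap_smul_algebraMap_X hd hsurj hz', hXop]
    congr 1
    rw [hy, ← mul_assoc, htz, smul_mul_assoc]

end ExponentialMap

/-! ### Truncated polynomial rings and d/dz -/

section TruncatedPolynomials

variable {F B : Type*} [Field F] [CommRing B] [Algebra F B] {z : B} {Q : ℕ}

/-- Write p = X^m r with r(0) ≠ 0. Then r(z) is a unit, being a nonzero constant plus a nilpotent,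
so z^m = 0 and m ≥ Q. -/
theorem X_pow_dvd_of_aeval_eq_zero (hz : z ^ Q = 0) (hz' : z ^ (Q - 1) ≠ 0) {p : F[X]}
    (hp : aeval z p = 0) : X ^ Q ∣ p := by
  by_cases hp0 : p = 0
  · exact hp0 ▸ dvd_zero _
  obtain ⟨r, hr, hr0⟩ := exists_eq_pow_rootMultiplicity_mul_and_not_dvd p hp0 0
  rw [C_0, sub_zero] at hr hr0
  by_contra hdvd
  have hlt : rootMultiplicity 0 p < Q := by
    by_contra hle
    exact hdvd (hr ▸ Dvd.dvd.mul_right (pow_dvd_pow X (not_lt.1 hle)) r)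
  have hunit : IsUnit (aeval z r) := by
    obtain ⟨s, hs⟩ : X ∣ r - C (r.coeff 0) := by
      rw [X_dvd_iff]; simp
    have h1 : aeval z r = algebraMap F B (r.coeff 0) + z * aeval z s := by
      have := congrArg (aeval z) hs
      rw [map_sub, aeval_C, map_mul, aeval_X] at this
      rw [← this]; ring
    have h2 : r.coeff 0 ≠ 0 := fun h => hr0 (X_dvd_iff.2 h)
    rw [h1]
    refine IsNilpotent.isUnit_add_left_of_commute ⟨Q, by rw [mul_pow, hz, zero_mul]⟩
      ((IsUnit.mk0 _ h2).map (algebraMap F B)) (Commute.all _ _)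
  rw [hr, map_mul, map_pow, aeval_X, hunit.mul_left_eq_zero] at hp
  exact hz' (pow_eq_zero_of_le (by omega) hp)

/-- The derivation `d/dz` of the truncated polynomial ring `F[z]/(z ^ Q)`, where `Q = 0` in `F`. -/
theorem exists_derivation (hsurj : Function.Surjective (aeval z : F[X] →ₐ[F] B)) (hz : z ^ Q = 0)
    (hker : ∀ p : F[X], aeval z p = 0 → X ^ Q ∣ p) (hQ : (Q : F) = 0) :
    ∃ D : Derivation F B B, D z = 1 := by
  -- Differentiation preserves the ideal (X^Q) because Q = 0 in `F`.
  have hwd : ∀ p r : F[X], aeval z p = aeval z r → aeval z (derivative p) = aeval z (derivative r) := by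
    intro p r h
    obtain ⟨s, hs⟩ := hker (p - r) (by rw [map_sub, h, sub_self])
    rw [← sub_eq_zero, ← map_sub, ← derivative_sub, hs, derivative_mul, derivative_X_pow, hQ]
    simp [hz]
  choose l hl using hsurj
  have hD : ∀ p : F[X], aeval z (derivative (l (aeval z p))) = aeval z (derivative p) :=
    fun p => hwd _ _ (hl _)
  refine ⟨Derivation.mk' { toFun := fun x => aeval z (derivative (l x)), map_add' := ?_, map_smul' := ?_ } ?_, ?_⟩
  · intro x y
    rw [← map_add, ← derivative_add]
    exact hwd _ _ (by rw [hl, map_add, hl, hl])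
  · intro c x
    rw [RingHom.id_apply, ← map_smul, ← derivative_smul]
    exact hwd _ _ (by rw [hl, map_smul, hl])
  · intro x y
    change aeval z (derivative (l (x * y))) = x * aeval z (derivative (l y)) + y * aeval z (derivative (l x))
    rw [hwd (l (x * y)) (l x * l y) (by rw [hl, map_mul, hl, hl]), derivative_mul, map_add, map_mul, map_mul, hl, hl]
    ring
  · change aeval z (derivative (l z)) = 1
    rw [hwd (l z) X (by rw [hl, aeval_X]), derivative_X, map_one]

end TruncatedPolynomials

end Carlitz

namespace Carlitz

/-! ### Functoriality and divisibility for the Carlitz action -/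

section Functoriality

variable {k : Type*} [Field k] [Fintype k]
  {E E' : Type*} [CommRing E] [Algebra k E] [Algebra k[X] E] [IsScalarTower k k[X] E]
  [CommRing E'] [Algebra k E'] [Algebra k[X] E'] [IsScalarTower k k[X] E']

omit [IsScalarTower k k[X] E] in
theorem op_apply (x : E) : op k E x = algebraMap k[X] E X * x + x ^ Fintype.card k := rfl

theorem map_aeval_op (f : E →ₐ[k[X]] E') (a : k[X]) (x : E) :
    f (aeval (op k E) a x) = aeval (op k E') a (f x) := by
  induction a using Polynomial.induction_on generalizing x with
  | C c =>
    rw [aeval_C, aeval_C, Module.algebraMap_end_apply, Module.algebraMap_end_apply]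
    exact map_smul (f.restrictScalars k) c x
  | add p r hp hr => simp only [map_add, LinearMap.add_apply, hp, hr]
  | monomial n c ih =>
    have hop : f (op k E x) = op k E' (f x) := by
      rw [op_apply, op_apply, map_add, map_mul, map_pow, f.commutes]
    rw [pow_succ, ← mul_assoc, map_mul, aeval_X, Module.End.mul_apply, ih, map_mul _ _ X, aeval_X,
      Module.End.mul_apply, hop]

omit [IsScalarTower k k[X] E] in
theorem dvd_aeval_op (a : k[X]) (x : E) : x ∣ aeval (op k E) a x := by
  induction a using Polynomial.induction_on generalizing x with
  | C c =>
    rw [aeval_C, Module.algebraMap_end_apply, Algebra.smul_def]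
    exact dvd_mul_left _ _
  | add p r hp hr =>
    rw [map_add, LinearMap.add_apply]
    exact dvd_add (hp x) (hr x)
  | monomial n c ih =>
    rw [pow_succ, ← mul_assoc, map_mul, aeval_X, Module.End.mul_apply]
    refine Dvd.dvd.trans ?_ (ih _)
    rw [op_apply]
    exact dvd_add (dvd_mul_left _ _) (dvd_pow_self x Fintype.card_ne_zero)

end Functoriality

/-! ### The ring R/𝔓^Q as a truncated polynomial ring over A/𝔭 -/

section CoefficientRing

variable {k : Type*} [Field k] [Fintype k] (𝔭 : HeightOneSpectrum k[X])
  {R : Type*} [CommRing R] [Algebra k R] [Algebra k[X] R] [IsScalarTower k k[X] R]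
  (𝔓 : Ideal R) [𝔓.LiesOver 𝔭.asIdeal] (Q : ℕ)

/-- The field structure of the residue field `A/𝔭`. -/
noncomputable abbrev residueField : Field (k[X] ⧸ 𝔭.asIdeal) := Ideal.Quotient.field _

/-- The `A/𝔭`-algebra structure of `R/𝔓^m` given by `coeffLift`. -/
noncomputable abbrev coeffAlgebra : Algebra (k[X] ⧸ 𝔭.asIdeal) (R ⧸ 𝔓 ^ Q) :=
  (coeffLift 𝔭 𝔓 Q).toRingHom.toAlgebra

attribute [local instance] residueField coeffAlgebra

theorem isScalarTower_coeffAlgebra : IsScalarTower k (k[X] ⧸ 𝔭.asIdeal) (R ⧸ 𝔓 ^ Q) :=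
  IsScalarTower.of_algebraMap_eq fun c => ((coeffLift 𝔭 𝔓 Q).commutes c).symm

variable {𝔭 𝔓 Q}

theorem algebraMap_coeffAlgebra (c : k[X] ⧸ 𝔭.asIdeal) :
    algebraMap (k[X] ⧸ 𝔭.asIdeal) (R ⧸ 𝔓 ^ Q) c = coeffLift 𝔭 𝔓 Q c := rfl

variable [Fintype (k[X] ⧸ 𝔭.asIdeal)] (hQ : Fintype.card (k[X] ⧸ 𝔭.asIdeal) = Q)

omit [Fintype k] in
include hQ in
theorem sub_pow_card_mem (a : k[X]) : a - a ^ Q ∈ 𝔭.asIdeal := by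
  rw [← Ideal.Quotient.eq, map_pow, ← hQ, FiniteField.pow_card]

include hQ in
-- The lift c of a is congruent to a modulo 𝔓, so (c - a)^Q = 0. Since c^Q = c, the lift is the
-- Teichmüller representative a^Q.
theorem coeffLift_mk (a : k[X]) : coeffLift 𝔭 𝔓 Q (Ideal.Quotient.mk _ a) =
    Ideal.Quotient.mk _ (algebraMap k[X] R a ^ Q) := by
  have := isScalarTower_coeffAlgebra 𝔭 𝔓 Q
  have h1 := (eq_coeffLift_iff 𝔭 𝔓 Q _).1 rfl
  have h2 := DFunLike.congr_fun h1 (Ideal.Quotient.mk _ a)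
  have h3 : coeffLift 𝔭 𝔓 Q (Ideal.Quotient.mk _ a) -
      Ideal.Quotient.mk _ (algebraMap k[X] R a) ∈ 𝔓.map (Ideal.Quotient.mk (𝔓 ^ Q)) := by
    rw [← Ideal.Quotient.eq]
    exact h2
  have h4 := Ideal.pow_mem_pow h3 Q
  rw [← Ideal.map_pow, Ideal.map_quotient_self, Ideal.mem_bot] at h4
  have hc : Fintype.card (k[X] ⧸ 𝔭.asIdeal) =
      Fintype.card k ^ Module.finrank k (k[X] ⧸ 𝔭.asIdeal) := Module.card_eq_pow_finrank
  rw [← hQ, pow_card_sub hc, sub_eq_zero] at h4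
  subst hQ
  rw [map_pow, ← h4, ← map_pow, FiniteField.pow_card]

include hQ in
theorem algebraMap_coeffAlgebra_algebraMap (a : k[X]) :
    algebraMap (k[X] ⧸ 𝔭.asIdeal) (R ⧸ 𝔓 ^ Q) (algebraMap k[X] _ a) =
      Ideal.Quotient.mk _ (algebraMap k[X] R a ^ Q) :=
  coeffLift_mk hQ a

variable {lam : R} (h𝔓 : 𝔓 = Ideal.span {lam})

include h𝔓 in
omit [Algebra k R] [Algebra k[X] R] [IsScalarTower k k[X] R] [Fintype k] [𝔓.LiesOver 𝔭.asIdeal] in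
theorem mem_pow_iff_dvd {r : R} (m : ℕ) : r ∈ 𝔓 ^ m ↔ lam ^ m ∣ r := by
  rw [h𝔓, Ideal.span_singleton_pow, Ideal.mem_span_singleton]

include h𝔓 in
theorem mk_pow_eq_zero : (Ideal.Quotient.mk (𝔓 ^ Q) lam) ^ Q = 0 := by
  rw [← map_pow, Ideal.Quotient.eq_zero_iff_mem, mem_pow_iff_dvd h𝔓]

include h𝔓 in
theorem mk_pow_pred_ne_zero [IsDomain R] (hprime : 𝔓 ≠ ⊤) (h0 : lam ≠ 0) (hQ0 : Q ≠ 0) :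
    (Ideal.Quotient.mk (𝔓 ^ Q) lam) ^ (Q - 1) ≠ 0 := by
  rw [← map_pow, Ne, Ideal.Quotient.eq_zero_iff_mem, mem_pow_iff_dvd h𝔓]
  intro h
  obtain ⟨Q, rfl⟩ := Nat.exists_eq_succ_of_ne_zero hQ0
  rw [Nat.succ_sub_one, Nat.succ_eq_add_one, pow_succ] at h
  obtain ⟨c, hc⟩ := h
  have : lam * c = 1 := mul_left_cancel₀ (pow_ne_zero Q h0) (by rw [mul_one, ← mul_assoc, ← hc])
  exact hprime (h𝔓 ▸ Ideal.span_singleton_eq_top.2 (.of_mul_eq_one _ this))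

include h𝔓 in
-- Every element has a λ-adic expansion with Teichmüller digits a^Q.
theorem aeval_mk_surjective (hQ : Fintype.card (k[X] ⧸ 𝔭.asIdeal) = Q)
    (hres : ∀ r : R, ∃ a : k[X], r - algebraMap k[X] R a ∈ 𝔓) :
    Function.Surjective
      (aeval (Ideal.Quotient.mk (𝔓 ^ Q) lam) : (k[X] ⧸ 𝔭.asIdeal)[X] →ₐ[_] R ⧸ 𝔓 ^ Q) := by
  have key : ∀ (i : ℕ) (r : R), ∃ p : (k[X] ⧸ 𝔭.asIdeal)[X],
      (Ideal.Quotient.mk (𝔓 ^ Q) lam) ^ i ∣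
        Ideal.Quotient.mk (𝔓 ^ Q) r - aeval (Ideal.Quotient.mk (𝔓 ^ Q) lam) p := by
    intro i
    induction i with
    | zero => exact fun r => ⟨0, by simp⟩
    | succ i ih =>
      intro r
      obtain ⟨a, ha⟩ := hres r
      have ha' : r - algebraMap k[X] R a ^ Q ∈ 𝔓 := by
        have h1 := (Ideal.mem_of_liesOver 𝔓 𝔭.asIdeal _).1 (sub_pow_card_mem hQ a)
        rw [map_sub, map_pow] at h1
        simpa using add_mem ha h1
      rw [h𝔓, Ideal.mem_span_singleton] at ha'
      obtain ⟨r', hr'⟩ := ha'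
      obtain ⟨p, c, hc⟩ := ih r'
      refine ⟨C (algebraMap k[X] _ a) + X * p, c, ?_⟩
      rw [map_add, aeval_C, algebraMap_coeffAlgebra_algebraMap hQ, map_mul, aeval_X, pow_succ',
        mul_assoc, ← hc, sub_add_eq_sub_sub, ← map_sub, hr', map_mul, mul_sub]
  intro b
  obtain ⟨r, rfl⟩ := Ideal.Quotient.mk_surjective b
  obtain ⟨p, hp⟩ := key Q r
  rw [mk_pow_eq_zero h𝔓, zero_dvd_iff, sub_eq_zero] at hp
  exact ⟨p, hp.symm⟩

variable (𝔭) in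
include 𝔭 h𝔓 in
omit [Algebra k R] [IsScalarTower k k[X] R] [Fintype k] in
theorem finite_quotient_pow (hres : ∀ r : R, ∃ a : k[X], r - algebraMap k[X] R a ∈ 𝔓) :
    Finite (R ⧸ 𝔓 ^ Q) := by
  have : Finite (R ⧸ 𝔓) := by
    refine Finite.of_surjective (algebraMap (k[X] ⧸ 𝔭.asIdeal) (R ⧸ 𝔓)) fun b => ?_
    obtain ⟨r, rfl⟩ := Ideal.Quotient.mk_surjective b
    obtain ⟨a, ha⟩ := hres r
    exact ⟨Ideal.Quotient.mk _ a, (Ideal.Quotient.eq.2 ha).symm⟩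
  exact Ideal.finite_quotient_pow (h𝔓 ▸ Submodule.fg_span_singleton lam) Q

include h𝔓 in
-- The two actions of a differ by a - a^Q in 𝔭, hence by a multiple of λ^(Q-1); one more factor λ
-- lands in 𝔓^Q. This is where ramification index Q-1 enters the local computation.
theorem algebraMap_mul_mk_lam (hQ : Fintype.card (k[X] ⧸ 𝔭.asIdeal) = Q)
    (hram : ∀ a ∈ 𝔭.asIdeal, lam ^ (Q - 1) ∣ algebraMap k[X] R a) (a : k[X]) :
    algebraMap k[X] (R ⧸ 𝔓 ^ Q) a * Ideal.Quotient.mk _ lam =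
      (algebraMap k[X] (k[X] ⧸ 𝔭.asIdeal) a) • Ideal.Quotient.mk _ lam := by
  rw [Algebra.smul_def, algebraMap_coeffAlgebra_algebraMap hQ]
  change Ideal.Quotient.mk (𝔓 ^ Q) (algebraMap k[X] R a) * _ = _
  rw [← map_mul, ← map_mul, Ideal.Quotient.eq, mem_pow_iff_dvd h𝔓, ← sub_mul, ← map_pow, ← map_sub]
  have h := mul_dvd_mul (hram _ (sub_pow_card_mem hQ a)) (dvd_refl lam)
  rwa [← pow_succ, Nat.sub_add_cancel (by rw [← hQ]; exact Fintype.card_pos)] at h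

omit [𝔓.LiesOver 𝔭.asIdeal] [IsScalarTower k k[X] R] [Algebra k[X] R] in
include hQ in
theorem natCast_card_eq_zero : (Q : R) = 0 := by
  have hc : Fintype.card (k[X] ⧸ 𝔭.asIdeal) =
      Fintype.card k ^ Module.finrank k (k[X] ⧸ 𝔭.asIdeal) := Module.card_eq_pow_finrank
  have hd : Module.finrank k (k[X] ⧸ 𝔭.asIdeal) ≠ 0 := by
    intro h
    rw [h, pow_zero] at hc
    exact absurd hc Fintype.one_lt_card.ne'
  rw [← hQ, hc, Nat.cast_pow, ← map_natCast (algebraMap k R), FiniteField.cast_card_eq_zero, map_zero, zero_pow hd]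

/-- A derivation `D` of `R/𝔓^Q` with `D z = 1`, where `z` generates `R/𝔓^Q` over `A/𝔭`, identifies
`Ω_R/𝔓^Q Ω_R` with a submodule of `R/𝔓^Q`. -/
theorem exists_injective_of_derivation (hQ : Fintype.card (k[X] ⧸ 𝔭.asIdeal) = Q)
    (h𝔓 : 𝔓 = Ideal.span {lam}) {z : R ⧸ 𝔓 ^ Q}
    (hsurj : Function.Surjective (aeval z : (k[X] ⧸ 𝔭.asIdeal)[X] →ₐ[_] R ⧸ 𝔓 ^ Q))
    (D : Derivation (k[X] ⧸ 𝔭.asIdeal) (R ⧸ 𝔓 ^ Q) (R ⧸ 𝔓 ^ Q)) (hD : D z = 1) :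
    ∃ Θ : (Ω[R⁄k] ⧸ (𝔓 ^ Q • ⊤ : Submodule R Ω[R⁄k])) →ₗ[R] R ⧸ 𝔓 ^ Q, Function.Injective Θ ∧
      ∀ x : R, Θ (Submodule.Quotient.mk (KaehlerDifferential.D k R x)) =
        D (Ideal.Quotient.mk _ x) := by
  have := isScalarTower_coeffAlgebra 𝔭 𝔓 Q
  let D₁ : Derivation k (R ⧸ 𝔓 ^ Q) (R ⧸ 𝔓 ^ Q) := D.restrictScalars k
  let D₂ : Derivation k R (R ⧸ 𝔓 ^ Q) := D₁.compAlgebraMap R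
  have hle : (𝔓 ^ Q • ⊤ : Submodule R Ω[R⁄k]) ≤ LinearMap.ker D₂.liftKaehlerDifferential := by
    rw [Submodule.smul_le]
    intro r hr ω _
    rw [LinearMap.mem_ker, map_smul, Algebra.smul_def]
    change Ideal.Quotient.mk _ r * _ = 0
    rw [Ideal.Quotient.eq_zero_iff_mem.2 hr, zero_mul]
  let Θ := Submodule.liftQ _ _ hle
  have hΘ : ∀ x : R, Θ (Submodule.Quotient.mk (KaehlerDifferential.D k R x)) =
        D (Ideal.Quotient.mk _ x) := fun x => D₂.liftKaehlerDifferential_comp_D x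
  refine ⟨Θ, ?_, hΘ⟩
  obtain ⟨z', hz'⟩ := Ideal.Quotient.mk_surjective z
  let δ : Derivation k R (Ω[R⁄k] ⧸ (𝔓 ^ Q • ⊤ : Submodule R Ω[R⁄k])) :=
    (Submodule.mkQ (𝔓 ^ Q • ⊤ : Submodule R Ω[R⁄k])).compDer (KaehlerDifferential.D k R)
  have hQ0 : (Q : R) = 0 := natCast_card_eq_zero hQ
  have hpow : ∀ r : R, δ (r ^ Q) = 0 := fun r => by
    rw [Derivation.leibniz_pow, ← Nat.cast_smul_eq_nsmul R, hQ0, zero_smul]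
  have hzero : ∀ r ∈ 𝔓 ^ Q, ∀ ω : Ω[R⁄k] ⧸ (𝔓 ^ Q • ⊤ : Submodule R Ω[R⁄k]), r • ω = 0 := by
    intro r hr ω
    obtain ⟨ω, rfl⟩ := Submodule.Quotient.mk_surjective _ ω
    rw [← Submodule.Quotient.mk_smul, Submodule.Quotient.mk_eq_zero]
    exact Submodule.smul_mem_smul hr trivial
  -- For y = λ^Q c, the differential of λ^Q vanishes since Q = 0 in `R`, and λ^Q dc is zero in the
  -- quotient.
  have hker : ∀ y ∈ 𝔓 ^ Q, δ y = 0 := by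
    intro y hy
    obtain ⟨c, rfl⟩ := (mem_pow_iff_dvd h𝔓 Q).1 hy
    rw [Derivation.leibniz, hpow, smul_zero, add_zero, hzero]
    exact (mem_pow_iff_dvd h𝔓 Q).2 (dvd_refl _)
  let N : Submodule R (Ω[R⁄k] ⧸ (𝔓 ^ Q • ⊤ : Submodule R Ω[R⁄k])) := Submodule.span R {δ z'}
  let S : Subring R :=
    { carrier := {x | δ x ∈ N}
      mul_mem' := fun {x y} hx hy => by
        rw [Set.mem_ofPred_eq, Derivation.leibniz]
        exact add_mem (N.smul_mem _ hy) (N.smul_mem _ hx)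
      one_mem' := by
        rw [Set.mem_ofPred_eq, Derivation.map_one_eq_zero]
        exact zero_mem _
      add_mem' := fun {x y} hx hy => by
        rw [Set.mem_ofPred_eq, map_add]
        exact add_mem hx hy
      zero_mem' := by
        rw [Set.mem_ofPred_eq, map_zero]
        exact zero_mem _
      neg_mem' := fun {x} hx => by
        rw [Set.mem_ofPred_eq, map_neg]
        exact neg_mem hx }
  -- Coefficients lift to Q-th powers, which have zero differential, so every polynomial in z lifts
  -- to an element whose differential is a multiple of dz'. Thus dz' generates the quotient of
  -- differentials.
  have hS : ∀ p : (k[X] ⧸ 𝔭.asIdeal)[X], aeval z p ∈ S.map (Ideal.Quotient.mk (𝔓 ^ Q)) := by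
    have hz : z ∈ S.map (Ideal.Quotient.mk (𝔓 ^ Q)) :=
      ⟨z', Submodule.mem_span_singleton_self (δ z'), hz'⟩
    intro p
    rw [aeval_eq_sum_range]
    refine sum_mem fun i _ => ?_
    obtain ⟨a, ha⟩ := Ideal.Quotient.mk_surjective (p.coeff i)
    rw [Algebra.smul_def, ← ha, algebraMap_coeffAlgebra, coeffLift_mk hQ]
    refine mul_mem ⟨_, ?_, rfl⟩ (pow_mem hz i)
    change δ _ ∈ N
    rw [hpow]
    exact zero_mem _
  have hN : ∀ ω, ω ∈ N := by
    have h1 : ∀ x, δ x ∈ N := by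
      intro x
      obtain ⟨p, hp⟩ := hsurj (Ideal.Quotient.mk _ x)
      obtain ⟨s, hs, hsx⟩ := hS p
      rw [hp] at hsx
      have h2 := hker _ (Ideal.Quotient.eq.1 hsx.symm)
      rw [map_sub, sub_eq_zero] at h2
      rw [h2]
      exact hs
    intro ω
    obtain ⟨ω, rfl⟩ := Submodule.Quotient.mk_surjective _ ω
    have h3 : (⊤ : Submodule R Ω[R⁄k]) ≤ N.comap (Submodule.mkQ _) := by
      refine (KaehlerDifferential.span_range_derivation k R).ge.trans (Submodule.span_le.2 ?_)
      rintro _ ⟨x, rfl⟩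
      exact h1 x
    exact h3 trivial
  rw [← LinearMap.ker_eq_bot, LinearMap.ker_eq_bot']
  intro ω hω
  obtain ⟨r, rfl⟩ := Submodule.mem_span_singleton.1 (hN ω)
  have h4 : Θ (δ z') = 1 := (hΘ z').trans (by rw [hz', hD])
  rw [map_smul, h4, Algebra.smul_def, mul_one] at hω
  exact hzero r (Ideal.Quotient.eq_zero_iff_mem.1 hω) _

theorem apply_reduceDifferentials_dlog
    (Θ : (Ω[R⁄k] ⧸ (𝔓 ^ Q • ⊤ : Submodule R Ω[R⁄k])) →ₗ[R] R ⧸ 𝔓 ^ Q)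
    (D : Derivation (k[X] ⧸ 𝔭.asIdeal) (R ⧸ 𝔓 ^ Q) (R ⧸ 𝔓 ^ Q))
    (hΘ : ∀ x : R, Θ (Submodule.Quotient.mk (KaehlerDifferential.D k R x)) =
        D (Ideal.Quotient.mk _ x)) (c : k[X] ⧸ 𝔭.asIdeal) (u : Rˣ) :
    Θ (reduceDifferentials 𝔭 𝔓 Q (dlog 𝔭 (c ⊗ₜ Additive.ofMul u))) =
      c • ((((Units.map (Ideal.Quotient.mk (𝔓 ^ Q)).toMonoidHom u)⁻¹ : (R ⧸ 𝔓 ^ Q)ˣ) : R ⧸ 𝔓 ^ Q) *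
        D (Units.map (Ideal.Quotient.mk (𝔓 ^ Q)).toMonoidHom u : (R ⧸ 𝔓 ^ Q)ˣ)) := by
  have h1 : reduceDifferentials 𝔭 𝔓 Q (dlog 𝔭 (c ⊗ₜ Additive.ofMul u)) =
      coeffLift 𝔭 𝔓 Q c • Submodule.Quotient.mk
        (((u⁻¹ : Rˣ) : R) • KaehlerDifferential.D k R (u : R)) := rfl
  obtain ⟨r, hr⟩ := Ideal.Quotient.mk_surjective (coeffLift 𝔭 𝔓 Q c)
  have h2 : ∀ ω : Ω[R⁄k] ⧸ (𝔓 ^ Q • ⊤ : Submodule R Ω[R⁄k]),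
      Ideal.Quotient.mk (𝔓 ^ Q) r • ω = r • ω := fun _ => rfl
  rw [h1, ← hr, h2, Submodule.Quotient.mk_smul, map_smul, map_smul, hΘ, Algebra.smul_def,
    Algebra.smul_def, Algebra.smul_def, algebraMap_coeffAlgebra, ← hr, ← map_inv]
  rfl

/-- The automorphism of the `A/𝔭`-algebra `R/𝔓^Q` induced by an automorphism of the `A`-algebra
`R`. -/
noncomputable def quotientAlgHom (hQ : Fintype.card (k[X] ⧸ 𝔭.asIdeal) = Q) (σ : R →ₐ[k[X]] R)
    (hσ : 𝔓 ^ Q ≤ (𝔓 ^ Q).comap σ) : (R ⧸ 𝔓 ^ Q) →ₐ[k[X] ⧸ 𝔭.asIdeal] R ⧸ 𝔓 ^ Q where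
  __ := Ideal.quotientMapₐ (𝔓 ^ Q) σ hσ
  commutes' c := by
    obtain ⟨a, rfl⟩ := Ideal.Quotient.mk_surjective c
    rw [algebraMap_coeffAlgebra, coeffLift_mk hQ]
    change Ideal.Quotient.mk (𝔓 ^ Q) (σ (algebraMap k[X] R a ^ Q)) = _
    rw [map_pow, σ.commutes]

theorem quotientAlgHom_mk (hQ : Fintype.card (k[X] ⧸ 𝔭.asIdeal) = Q) (σ : R →ₐ[k[X]] R)
    (hσ : 𝔓 ^ Q ≤ (𝔓 ^ Q).comap σ) (r : R) :
    quotientAlgHom hQ σ hσ (Ideal.Quotient.mk _ r) = Ideal.Quotient.mk _ (σ r) := rfl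

variable [IsDomain R]

/-- The uniformizer λ is replaced by its Carlitz logarithm z. In this coordinate the automorphisms
become the scalings z ↦ cz, and the local criterion applies. -/
theorem reduceDifferentials_dlog_eq_zero_iff {d : ℕ}
    (hd : Fintype.card (k[X] ⧸ 𝔭.asIdeal) = Fintype.card k ^ d)
    [DecidableEq (k[X] ⧸ 𝔭.asIdeal)]
    (hQ : Fintype.card (k[X] ⧸ 𝔭.asIdeal) = Q) (h𝔓 : 𝔓 = Ideal.span {lam})
    (h𝔓' : 𝔓 ≠ ⊤) (h0 : lam ≠ 0)
    (hres : ∀ r : R, ∃ a : k[X], r - algebraMap k[X] R a ∈ 𝔓)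
    (hram : ∀ a ∈ 𝔭.asIdeal, lam ^ (Q - 1) ∣ algebraMap k[X] R a)
    (σ : (k[X] ⧸ 𝔭.asIdeal)ˣ → R →ₐ[k[X]] R) (u : (k[X] ⧸ 𝔭.asIdeal)ˣ → Rˣ)
    (hσ : ∀ c, σ c lam = u c * lam) (hcoc : ∀ b c, (u (b * c) : R) = σ b (u c) * u b)
    (hφ : ∀ (c : (k[X] ⧸ 𝔭.asIdeal)ˣ) (a : k[X]), algebraMap k[X] (k[X] ⧸ 𝔭.asIdeal) a = c →
      σ c lam = aeval (op k R) a lam)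
    {n : ℕ} (hn : 1 ≤ n) (hn' : n < Q - 1) :
    reduceDifferentials 𝔭 𝔓 Q (dlog 𝔭 (∑ c : (k[X] ⧸ 𝔭.asIdeal)ˣ,
      (((c⁻¹ : (k[X] ⧸ 𝔭.asIdeal)ˣ) : k[X] ⧸ 𝔭.asIdeal) ^ n) ⊗ₜ Additive.ofMul (u c))) = 0 ↔
      BC k (k[X] ⧸ 𝔭.asIdeal) n = 0 := by
  have := isScalarTower_coeffAlgebra 𝔭 𝔓 Q
  have := finite_quotient_pow (Q := Q) 𝔭 h𝔓 hres
  have hA : Function.Surjective (algebraMap k[X] (k[X] ⧸ 𝔭.asIdeal)) :=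
    Ideal.Quotient.mk_surjective
  set x := Ideal.Quotient.mk (𝔓 ^ Q) lam with hx
  have hxQ : x ^ Q = 0 := mk_pow_eq_zero h𝔓
  obtain ⟨z, hxz, hzx, hzQ, hz⟩ := exists_expMap_eq (F := k[X] ⧸ 𝔭.asIdeal) hd
    (x := x) (by rw [hQ]; exact hxQ)
  have hzQ' : z ^ Q = 0 := by rwa [hQ] at hzQ
  have hzne : z ^ (Q - 1) ≠ 0 := by
    intro h
    obtain ⟨y, hy⟩ := hzx
    refine mk_pow_pred_ne_zero h𝔓 h𝔓' h0 (by omega) (Q := Q) ?_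
    rw [← hx, hy, mul_pow, h, zero_mul]
  have hsurj : Function.Surjective (aeval z : (k[X] ⧸ 𝔭.asIdeal)[X] →ₐ[_] R ⧸ 𝔓 ^ Q) := by
    intro b
    obtain ⟨p, hp⟩ := aeval_mk_surjective h𝔓 hQ hres b
    refine ⟨p.comp (expTrunc k _ d), ?_⟩
    rw [aeval_comp, ← expMap_apply, hz, hp]
  have hker : ∀ p : (k[X] ⧸ 𝔭.asIdeal)[X], aeval z p = 0 → X ^ Q ∣ p := fun p hp =>
    X_pow_dvd_of_aeval_eq_zero hzQ' hzne hp
  obtain ⟨D, hD⟩ := exists_derivation hsurj hzQ' hker (natCast_card_eq_zero hQ)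
  obtain ⟨Θ, hΘinj, hΘ⟩ := exists_injective_of_derivation hQ h𝔓 hsurj D hD
  have htz : algebraMap k[X] (R ⧸ 𝔓 ^ Q) X * z =
      (algebraMap k[X] (k[X] ⧸ 𝔭.asIdeal) X) • z := by
    obtain ⟨y, hy⟩ := hxz
    rw [hy, ← mul_assoc, algebraMap_mul_mk_lam h𝔓 hQ hram, smul_mul_assoc]
  have hσle : ∀ c, 𝔓 ^ Q ≤ (𝔓 ^ Q).comap (σ c) := by
    intro c r hr
    rw [Ideal.mem_comap]
    rw [mem_pow_iff_dvd h𝔓] at hr ⊢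
    obtain ⟨y, rfl⟩ := hr
    rw [map_mul, map_pow, hσ, mul_pow]
    exact Dvd.dvd.mul_right (dvd_mul_left _ _) _
  let γ := fun c => quotientAlgHom hQ (σ c) (hσle c)
  let v : (k[X] ⧸ 𝔭.asIdeal)ˣ → (R ⧸ 𝔓 ^ Q)ˣ := fun c =>
    Units.map (Ideal.Quotient.mk (𝔓 ^ Q)).toMonoidHom (u c)
  have hv : ∀ c, (v c : R ⧸ 𝔓 ^ Q) = Ideal.Quotient.mk _ (u c : R) := fun _ => rfl
  have hexp : ∀ c : (k[X] ⧸ 𝔭.asIdeal)ˣ, Ideal.Quotient.mk (𝔓 ^ Q) (σ c lam) =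
      expMap k (k[X] ⧸ 𝔭.asIdeal) (R ⧸ 𝔓 ^ Q) d ((c : k[X] ⧸ 𝔭.asIdeal) • z) := by
    intro c
    obtain ⟨a, ha⟩ := hA c
    rw [hφ c a ha, ← Ideal.Quotient.mkₐ_eq_mk k[X], map_aeval_op, Ideal.Quotient.mkₐ_eq_mk, ← hx, ← hz, aeval_op_expMap hd hA hzQ htz, ha]
  -- Both sides have exponential equal to the image of σ_c λ, and the exponential is injective on
  -- elements with vanishing Q-th power.
  have hγ : ∀ c, γ c z = (c : k[X] ⧸ 𝔭.asIdeal) • z := by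
    intro c
    refine expMap_injOn hd (by rw [← map_pow, hzQ, map_zero])
      (by rw [_root_.smul_pow, hzQ, smul_zero]) ?_
    rw [← hexp, ← quotientAlgHom_mk hQ (σ c) (hσle c), ← hx, ← hz, expMap_apply, expMap_apply, aeval_algHom_apply]
  have hcrit := twistedDlog_eq_zero_iff (k := k) hA hd hsurj hzQ (by rw [hQ]; exact hker) D hD γ hγ v
    (fun b c => by rw [hv, hcoc, map_mul, hv, hv]; rfl)
    (fun c => by rw [← expMap_apply, ← expMap_apply, hz, hv, hx, ← map_mul, ← hσ, hexp])
    (fun c b => by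
      rintro ⟨s, hs⟩
      obtain ⟨a, ha⟩ := hA b
      have h1 := hφ b a ha
      have h2 := hφ (c * b) (C s * a) (by
        rw [map_mul, ha, Units.val_mul, ← hs, ← algebraMap_eq, ← IsScalarTower.algebraMap_apply])
      rw [map_mul, aeval_C, Module.End.mul_apply, Module.algebraMap_end_apply, ← h1, hσ, hσ,
        ← smul_mul_assoc] at h2
      rw [hv, hv, mul_right_cancel₀ h0 h2, ← hs, algebraMap_smul]
      rfl) hn (by rw [hQ]; exact hn')
  rw [← hcrit, ← map_eq_zero_iff Θ hΘinj, twistedDlog, map_sum, map_sum, map_sum]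
  simp only [apply_reduceDifferentials_dlog Θ D hΘ]
  rfl

end CoefficientRing

end Carlitz

namespace Carlitz

/-! ### A criterion for total ramification -/

section TotallyRamified

open UniqueFactorizationMonoid in
/-- If `p R` is divisible by `P ^ N` through the `N`-th power of an element `lam ∈ P`, where `N` is at
least the rank of `R`, then `p` is totally ramified in `R` and `lam` generates `P`. -/
theorem totally_ramified_of_pow_dvd {A R : Type*} [CommRing A] [IsDomain A] [CommRing R]
    [IsDedekindDomain R] [Algebra A R] [Module.Finite A R] [Module.Flat A R]
    (p : Ideal A) [hpm : p.IsMaximal] (P : Ideal R) [hP : P.IsPrime] [P.LiesOver p]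
    (hp0 : p.map (algebraMap A R) ≠ ⊥) {lam : R} (hlam : lam ∈ P) {N : ℕ} (hN : N ≠ 0)
    (hpow : ∀ a ∈ p, lam ^ N ∣ algebraMap A R a) (hle : Module.finrank A R ≤ N) :
    Module.finrank A R = N ∧ P = Ideal.span {lam} ∧ ∀ r : R, ∃ a : A, r - algebraMap A R a ∈ P := by
  classical
  have hmap : p.map (algebraMap A R) ≤ Ideal.span {lam} ^ N := by
    rw [Ideal.map_le_iff_le_comap]
    intro a ha
    rw [Ideal.mem_comap, Ideal.span_singleton_pow, Ideal.mem_span_singleton]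
    exact hpow a ha
  have hspan : Ideal.span {lam} ≤ P := (Ideal.span_singleton_le_iff_mem P).2 hlam
  have hlam0 : Ideal.span {lam} ≠ ⊥ := by
    intro h
    rw [h, Ideal.bot_pow hN, le_bot_iff] at hmap
    exact hp0 hmap
  have hP0 : P ≠ ⊥ := ne_bot_of_le_ne_bot hlam0 hspan
  have hPprime : Prime P := Ideal.prime_of_isPrime hP0 hP
  have : P.IsMaximal := hP.isMaximal hP0
  have hfin : FiniteMultiplicity P (p.map (algebraMap A R)) :=
    FiniteMultiplicity.of_prime_left hPprime hp0
  have he := Ideal.IsDedekindDomain.ramificationIdx_eq_multiplicity p P hp0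
  have heN : N ≤ P.ramificationIdx A := by
    rw [he]
    exact hfin.le_multiplicity_of_pow_dvd
      (Ideal.dvd_iff_le.2 (hmap.trans (Ideal.pow_right_mono hspan N)))
  have hf : 0 < P.inertiaDeg A := Ideal.inertiaDeg_pos P A
  let _ : Fintype (p.primesOver R) := (Algebra.QuasiFinite.finite_primesOver p).fintype
  have hsum := Ideal.sum_ramification_inertia_eq_finrank p R
  let P' : p.primesOver R := ⟨P, hP, inferInstance⟩
  rw [← Finset.add_sum_erase _ _ (Finset.mem_univ P')] at hsum
  change P.ramificationIdx A * P.inertiaDeg A + _ = _ at hsum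
  have hmul : P.ramificationIdx A ≤ P.ramificationIdx A * P.inertiaDeg A := Nat.le_mul_of_pos_right _ hf
  -- In ∑ e f = rank ≤ N, the term of `P` already has e ≥ N. So its residue degree is 1 and no other
  -- prime lies over `p`.
  have hf1 : P.inertiaDeg A = 1 := by
    by_contra h
    have : N * 2 ≤ P.ramificationIdx A * P.inertiaDeg A := Nat.mul_le_mul heN (by omega)
    omega
  rw [hf1, mul_one] at hsum
  have hrest : ∑ q ∈ Finset.univ.erase P', q.1.ramificationIdx A * q.1.inertiaDeg A = 0 := by omega
  have hunique : ∀ q : Ideal R, q.IsPrime → q.LiesOver p → q = P := by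
    intro q hq hqp
    by_contra hne
    have h1 := (Finset.sum_eq_zero_iff.1 hrest) ⟨q, hq, hqp⟩
      (Finset.mem_erase.2 ⟨fun h => hne (congrArg Subtype.val h), Finset.mem_univ _⟩)
    exact (Nat.mul_pos (Ideal.ramificationIdx_pos q A) (Ideal.inertiaDeg_pos q A)).ne' h1
  refine ⟨by omega, ?_, ?_⟩
  · have hfac : ∀ q ∈ normalizedFactors (Ideal.span {lam}), q = P := by
      intro q hq
      have hqp : q.IsPrime := Ideal.isPrime_of_prime (prime_of_normalized_factor q hq)
      refine hunique q hqp ⟨hpm.eq_of_le (Ideal.comap_ne_top _ hqp.ne_top) fun a ha => ?_⟩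
      rw [Ideal.mem_comap]
      have h1 : Ideal.span {lam} ≤ q := Ideal.dvd_iff_le.1 (dvd_of_mem_normalizedFactors hq)
      have h2 := hmap.trans ((Ideal.pow_right_mono h1 N).trans (Ideal.pow_le_self hN))
      exact h2 (Ideal.mem_map_of_mem _ ha)
    have hprod := Ideal.prod_normalizedFactors_eq_self hlam0
    rw [Multiset.eq_replicate_card.2 hfac, Multiset.prod_replicate] at hprod
    set m := (normalizedFactors (Ideal.span {lam})).card
    -- Here (lam) = P^m, and p R is contained in (lam)^N = P^(mN). As the ramification index is N,
    -- this forces m ≤ 1.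
    have h1 : m * N ≤ P.ramificationIdx A := by
      rw [he]
      refine hfin.le_multiplicity_of_pow_dvd (Ideal.dvd_iff_le.2 ?_)
      rw [pow_mul, hprod]
      exact hmap
    have hm1 : m ≤ 1 := by
      by_contra h
      have : 2 * N ≤ m * N := Nat.mul_le_mul_right N (by omega)
      omega
    have hm0 : m ≠ 0 := by
      intro h
      rw [h, pow_zero, Ideal.one_eq_top] at hprod
      exact hP.ne_top (top_le_iff.1 (hprod ▸ hspan))
    have hm : m = 1 := by omega
    rw [hm, pow_one] at hprod
    exact hprod
  · intro r
    rw [Ideal.inertiaDeg_eq_of_isMaximal p P] at hf1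
    let _ : Field (A ⧸ p) := Ideal.Quotient.field p
    obtain ⟨c, hc⟩ := (finrank_eq_one_iff_of_nonzero' (1 : R ⧸ P) one_ne_zero).1 hf1
      (Ideal.Quotient.mk P r)
    obtain ⟨a, rfl⟩ := Ideal.Quotient.mk_surjective c
    refine ⟨a, ?_⟩
    rw [← Ideal.Quotient.eq, ← hc, Algebra.smul_def, mul_one]
    rfl

end TotallyRamified

/-! ### Degree, leading coefficient and derivative of φ(a)(x) -/

section CarlitzPolynomial

variable {k : Type*} [Field k] [Fintype k]
  {S : Type*} [CommRing S] [IsDomain S] [Algebra k S] [Algebra k[X] S] [IsScalarTower k k[X] S]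

theorem poly_eq {K : Type*} [Field K] [Algebra k K] [Algebra k[X] K] (a : k[X]) :
    poly K a = aeval (op k K[X]) a X := by
  rw [poly, LinearEquiv.symm_apply_eq]
  exact (Module.AEval.of_aeval_smul (op k K[X]) a X).symm

omit [IsDomain S] in
-- Frobenius has zero derivative, so only the multiplication part of φ(a) contributes. This gives
-- both separability of φ(f) and its linear coefficient f.
theorem derivative_aeval_op (a : k[X]) (y : S[X]) :
    derivative (aeval (op k S[X]) a y) = algebraMap k[X] S[X] a * derivative y := by
  have hq : ((Fintype.card k : ℕ) : S) = 0 := by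
    rw [← map_natCast (algebraMap k S), FiniteField.cast_card_eq_zero, map_zero]
  induction a using Polynomial.induction_on generalizing y with
  | C c =>
    rw [aeval_C, Module.algebraMap_end_apply, derivative_smul, ← algebraMap_eq,
      ← IsScalarTower.algebraMap_apply, Algebra.smul_def]
  | add p r hp hr => rw [map_add, LinearMap.add_apply, derivative_add, hp, hr, map_add, add_mul]
  | monomial n c ih =>
    rw [pow_succ, ← mul_assoc, map_mul, aeval_X, Module.End.mul_apply, ih, op_apply, map_mul _ _ X,
      derivative_add, derivative_mul, derivative_pow, hq, Polynomial.algebraMap_apply (X : k[X]), derivative_C, C_0]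
    ring

theorem op_pow_X_monic (n : ℕ) : ((op k S[X] ^ n) X).Monic ∧
    ((op k S[X] ^ n) X).natDegree = Fintype.card k ^ n := by
  have hq : 1 < Fintype.card k := Fintype.one_lt_card
  induction n with
  | zero => simp [monic_X]
  | succ n ih =>
    obtain ⟨hm, hdeg⟩ := ih
    set y := (op k S[X] ^ n) X with hy
    have hpos : 0 < Fintype.card k ^ n := pow_pos (by omega) n
    have hlt : (algebraMap k[X] S[X] X * y).natDegree < (y ^ Fintype.card k).natDegree := by
      rw [Polynomial.algebraMap_apply]
      refine (natDegree_C_mul_le _ _).trans_lt ?_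
      rw [hm.natDegree_pow, hdeg]
      exact lt_mul_of_one_lt_left hpos hq
    have hd : (algebraMap k[X] S[X] X * y).degree < (y ^ Fintype.card k).degree :=
      degree_lt_degree hlt
    rw [pow_succ', Module.End.mul_apply, ← hy, op_apply]
    refine ⟨(hm.pow _).add_of_right hd, ?_⟩
    rw [natDegree_add_eq_right_of_natDegree_lt hlt, hm.natDegree_pow, hdeg, pow_succ']

theorem aeval_op_X_natDegree {a : k[X]} (ha : a ≠ 0) :
    (aeval (op k S[X]) a X).natDegree = Fintype.card k ^ a.natDegree ∧
      (aeval (op k S[X]) a X).leadingCoeff = algebraMap k S a.leadingCoeff := by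
  have hq : 1 < Fintype.card k := Fintype.one_lt_card
  set n := a.natDegree with hn
  have hsum : aeval (op k S[X]) a X = ∑ i ∈ Finset.range n, a.coeff i • (op k S[X] ^ i) X +
      a.leadingCoeff • (op k S[X] ^ n) X := by
    rw [aeval_eq_sum_range, Finset.sum_range_succ, LinearMap.add_apply, LinearMap.sum_apply]
    rfl
  have hlow : (∑ i ∈ Finset.range n, a.coeff i • (op k S[X] ^ i) X).degree <
      (Fintype.card k ^ n : ℕ) := by
    rw [← mem_degreeLT (R := S)]
    refine sum_mem fun i hi => ?_
    rw [← algebraMap_smul S (a.coeff i)]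
    refine Submodule.smul_mem _ _ ?_
    rw [mem_degreeLT]
    refine degree_le_natDegree.trans_lt ?_
    rw [(op_pow_X_monic i).2]
    exact_mod_cast Nat.pow_lt_pow_right hq (Finset.mem_range.1 hi)
  have hc : algebraMap k S a.leadingCoeff ≠ 0 := by
    rw [Ne, FaithfulSMul.algebraMap_eq_zero_iff]
    exact leadingCoeff_ne_zero.2 ha
  have htop : (a.leadingCoeff • (op k S[X] ^ n) X).natDegree = Fintype.card k ^ n := by
    rw [← algebraMap_smul S, smul_eq_C_mul, natDegree_C_mul hc, (op_pow_X_monic n).2]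
  have htop0 : a.leadingCoeff • (op k S[X] ^ n) X ≠ 0 := by
    rw [← algebraMap_smul S]
    exact smul_ne_zero hc (op_pow_X_monic n).1.ne_zero
  have hlt : (∑ i ∈ Finset.range n, a.coeff i • (op k S[X] ^ i) X).degree <
      (a.leadingCoeff • (op k S[X] ^ n) X).degree := by
    rw [degree_eq_natDegree htop0, htop]
    exact hlow
  rw [hsum]
  refine ⟨(natDegree_add_eq_right_of_degree_lt hlt).trans htop, ?_⟩
  rw [leadingCoeff_add_of_degree_lt hlt, ← algebraMap_smul S, smul_eq_C_mul, leadingCoeff_mul, leadingCoeff_C,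
    (op_pow_X_monic n).1.leadingCoeff, mul_one]

end CarlitzPolynomial

end Carlitz

namespace Carlitz

/-! ### The 𝔭-torsion field: ramification and Galois group -/

section TorsionField

variable {k K L : Type*} [Field k] [Fintype k]
  [Field K] [Algebra k K] [Algebra k[X] K] [IsScalarTower k k[X] K] [IsFractionRing k[X] K]
  [Field L] [Algebra K L] [Algebra k L] [Algebra k[X] L] [IsScalarTower k k[X] L]
  [IsScalarTower k[X] K L] {𝔭 : HeightOneSpectrum k[X]}

omit [IsScalarTower k k[X] L] in
theorem torsionCoord_smul (a : k[X]) (x : Torsion 𝔭 L) :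
    torsionCoord (Ideal.Quotient.mk 𝔭.asIdeal a • x) = aeval (op k L) a (torsionCoord x) := by
  rw [torsionCoord, LinearEquiv.symm_apply_eq]
  refine Eq.trans ?_ (Module.AEval.of_aeval_smul (op k L) a (torsionCoord x)).symm
  rfl

omit [IsScalarTower k k[X] L] in
theorem torsionCoord_injective : Function.Injective (torsionCoord : Torsion 𝔭 L → L) :=
  fun _ _ h => Subtype.ext ((toPoints k L).symm.injective h)

omit [IsScalarTower k k[X] L] in
theorem torsionCoord_zero : torsionCoord (0 : Torsion 𝔭 L) = 0 := map_zero (toPoints k L).symm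

omit [IsScalarTower k k[X] L] in
theorem aeval_op_torsionCoord {a : k[X]} (ha : a ∈ 𝔭.asIdeal) (x : Torsion 𝔭 L) :
    aeval (op k L) a (torsionCoord x) = 0 := by
  rw [← torsionCoord_smul, ← torsionCoord_zero (k := k) (𝔭 := 𝔭)]
  exact congrArg torsionCoord
    (Subtype.ext ((Submodule.mem_torsionBySet_iff _ _).1 x.2 ⟨a, ha⟩))

omit [IsFractionRing k[X] K] in
theorem aeval_poly (a : k[X]) (x : L) : aeval x (poly K a) = aeval (op k L) a x := by
  rw [poly_eq]
  have h := map_aeval_op ((aeval x : K[X] →ₐ[K] L).restrictScalars k[X]) a X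
  rw [AlgHom.restrictScalars_apply, AlgHom.restrictScalars_apply, aeval_X] at h
  exact h

theorem isIntegral_torsionCoord (x : Torsion 𝔭 L) : IsIntegral k[X] (torsionCoord x) := by
  obtain ⟨f, hf⟩ := (IsPrincipalIdealRing.principal 𝔭.asIdeal).principal
  have hf0 : f ≠ 0 := fun h => 𝔭.ne_bot (by rw [hf, h]; simp)
  have hmem : f * C f.leadingCoeff⁻¹ ∈ 𝔭.asIdeal :=
    Ideal.mul_mem_right _ _ (hf ▸ Submodule.mem_span_singleton_self f)
  have hmonic := monic_mul_leadingCoeff_inv hf0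
  refine ⟨aeval (op k k[X][X]) (f * C f.leadingCoeff⁻¹) X, ?_, ?_⟩
  · rw [Monic, (aeval_op_X_natDegree hmonic.ne_zero).2, hmonic.leadingCoeff, map_one]
  · have h := map_aeval_op (aeval (torsionCoord x) : k[X][X] →ₐ[k[X]] L) (f * C f.leadingCoeff⁻¹) X
    rw [aeval_X, aeval_op_torsionCoord hmem] at h
    exact h

variable {f : k[X]} (hf : 𝔭.asIdeal = Ideal.span {f})

include hf

omit [IsFractionRing k[X] K] [Fintype k] in
theorem generator_ne_zero : f ≠ 0 := fun h => 𝔭.ne_bot (by rw [hf, h]; simp)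

omit [IsScalarTower k k[X] L] in
theorem exists_torsionCoord_eq {x : L} (hx : aeval (op k L) f x = 0) :
    ∃ y : Torsion 𝔭 L, torsionCoord y = x := by
  refine ⟨⟨toPoints k L x, ?_⟩, (toPoints k L).symm_apply_apply x⟩
  rw [Submodule.mem_torsionBySet_iff]
  rintro ⟨a, ha⟩
  have ha' : a ∈ 𝔭.asIdeal := ha
  rw [hf, Ideal.mem_span_singleton'] at ha'
  obtain ⟨b, rfl⟩ := ha'
  refine (Module.AEval.of_aeval_smul (op k L) (b * f) x).symm.trans ?_
  rw [map_mul, mul_smul]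
  change toPoints k L (aeval (op k L) b (aeval (op k L) f x)) = 0
  rw [hx, map_zero, map_zero]

theorem mem_rootSet_poly_iff {x : L} :
    x ∈ (poly K f).rootSet L ↔ ∃ y : Torsion 𝔭 L, torsionCoord y = x := by
  have hne : poly K f ≠ 0 := by
    intro h
    have h1 := (aeval_op_X_natDegree (S := K) (generator_ne_zero hf)).2
    rw [← poly_eq, h, leadingCoeff_zero, eq_comm, map_eq_zero, leadingCoeff_eq_zero] at h1
    exact generator_ne_zero hf h1
  rw [mem_rootSet, and_iff_right hne, aeval_poly]
  refine ⟨exists_torsionCoord_eq hf, ?_⟩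
  rintro ⟨y, rfl⟩
  exact aeval_op_torsionCoord (hf ▸ Ideal.mem_span_singleton_self f) y

theorem separable_poly : (poly K f).Separable := by
  rw [separable_def, poly_eq, derivative_aeval_op, derivative_X, mul_one,
    Polynomial.algebraMap_apply]
  have hne : algebraMap k[X] K f ≠ 0 := by
    rw [Ne, FaithfulSMul.algebraMap_eq_zero_iff]
    exact generator_ne_zero hf
  obtain ⟨b, hb⟩ := ((IsUnit.mk0 _ hne).map C).exists_left_inv
  exact ⟨0, b, by rw [zero_mul, zero_add, hb]⟩

theorem natDegree_poly : (poly K f).natDegree =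
    Fintype.card k ^ Module.finrank k (k[X] ⧸ 𝔭.asIdeal) := by
  rw [poly_eq, (aeval_op_X_natDegree (generator_ne_zero hf)).1, hf,
    finrank_quotient_span_eq_natDegree]

variable {lam : Torsion 𝔭 L}
  (hlam : Submodule.span (k[X] ⧸ 𝔭.asIdeal) {lam} = ⊤)

omit [IsScalarTower k k[X] L] hf in
include hlam in
theorem exists_aeval_op_eq (y : Torsion 𝔭 L) :
    ∃ a : k[X], torsionCoord y = aeval (op k L) a (torsionCoord lam) := by
  obtain ⟨c, rfl⟩ := Submodule.mem_span_singleton.1 (hlam ▸ Submodule.mem_top (x := y))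
  obtain ⟨a, rfl⟩ := Ideal.Quotient.mk_surjective c
  exact ⟨a, torsionCoord_smul a lam⟩

omit [IsScalarTower k k[X] L] hf in
include hlam in
theorem exists_aeval_op_eq' {y : Torsion 𝔭 L} (hy : y ≠ 0) :
    ∃ a : k[X], torsionCoord lam = aeval (op k L) a (torsionCoord y) := by
  let _ : Field (k[X] ⧸ 𝔭.asIdeal) := Ideal.Quotient.field _
  obtain ⟨c, rfl⟩ := Submodule.mem_span_singleton.1 (hlam ▸ Submodule.mem_top (x := y))
  have hc : c ≠ 0 := by
    rintro rfl
    refine hy (torsionCoord_injective ?_)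
    rw [← map_zero (Ideal.Quotient.mk 𝔭.asIdeal), torsionCoord_smul, map_zero, torsionCoord_zero]
    rfl
  obtain ⟨a, ha⟩ := Ideal.Quotient.mk_surjective c⁻¹
  refine ⟨a, ?_⟩
  rw [← torsionCoord_smul, ha, smul_smul, inv_mul_cancel₀ hc, one_smul]

variable (K) [(poly K f).IsSplittingField K L] in
include K hlam in
theorem torsionCoord_ne_zero : torsionCoord lam ≠ 0 := by
  intro h
  have h1 := card_rootSet_eq_natDegree (separable_poly (K := K) hf)
    (IsSplittingField.splits L (poly K f))
  have hsub : Subsingleton ((poly K f).rootSet L) := by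
    refine ⟨fun x y => Subtype.ext ?_⟩
    obtain ⟨x', hx'⟩ := (mem_rootSet_poly_iff hf).1 x.2
    obtain ⟨y', hy'⟩ := (mem_rootSet_poly_iff hf).1 y.2
    obtain ⟨a, ha⟩ := exists_aeval_op_eq hlam x'
    obtain ⟨b, hb⟩ := exists_aeval_op_eq hlam y'
    rw [← hx', ← hy', ha, hb, h, map_zero, map_zero]
  have h2 := Fintype.card_le_one_iff_subsingleton.2 hsub
  rw [h1, poly_eq, (aeval_op_X_natDegree (generator_ne_zero hf)).1] at h2
  have h3 : f.natDegree ≠ 0 := by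
    intro h0
    have h4 : IsUnit f := by
      rw [eq_C_of_natDegree_eq_zero h0]
      refine (IsUnit.mk0 _ fun hc => ?_).map C
      have := eq_C_of_natDegree_eq_zero h0
      rw [hc, C_0] at this
      exact generator_ne_zero hf this
    exact 𝔭.isPrime.ne_top (hf.trans (Ideal.span_singleton_eq_top.2 h4))
  exact absurd h2 (not_le.2 (Nat.one_lt_pow h3 Fintype.one_lt_card))

omit hf [IsFractionRing k[X] K] [IsScalarTower k k[X] K] [Algebra k K] in
include hlam in
theorem apply_torsionCoord (g : L ≃ₐ[K] L) {a : k[X]} (ha : Ideal.Quotient.mk _ a = chi 𝔭 g)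
    (x : Torsion 𝔭 L) : g (torsionCoord x) = aeval (op k L) a (torsionCoord x) := by
  rw [← torsionCoord_smul, ha, ← rep_apply_eq_chi_smul 𝔭 lam hlam]
  rfl

variable [(poly K f).IsSplittingField K L] in
include hlam in
-- The torsion points generate `L` over `K`, and an automorphism with χ(g) = 1 fixes them all.
theorem chi_injective : Function.Injective (chi 𝔭 : (L ≃ₐ[K] L) →* k[X] ⧸ 𝔭.asIdeal).toHomUnits := by
  rw [injective_iff_map_eq_one]
  intro g hg
  have hg1 : chi 𝔭 g = 1 := congrArg Units.val hg
  have h : (g : L →ₐ[K] L) = AlgHom.id K L := by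
    refine AlgHom.ext_of_adjoin_eq_top
      (IsSplittingField.adjoin_rootSet' (K := K) (L := L) (f := poly K f)) fun x hx => ?_
    obtain ⟨y, rfl⟩ := (mem_rootSet_poly_iff hf).1 hx
    refine (apply_torsionCoord hlam g (a := 1) (by rw [map_one, hg1]) y).trans ?_
    rw [map_one]
    rfl
  ext x
  exact DFunLike.congr_fun h x

omit [IsFractionRing k[X] K] in
variable (K L) in
-- Differentiate the factorization of φ(f)(x) into linear factors and evaluate at 0: the left side
-- gives f, the right side the product over the nonzero roots.
theorem algebraMap_generator_eq [DecidableEq L] [(poly K f).IsSplittingField K L] :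
    algebraMap k[X] L f = algebraMap k L f.leadingCoeff *
      ((((poly K f).map (algebraMap K L)).roots.erase 0).map fun r => -r).prod := by
  set p := (poly K f).map (algebraMap K L) with hp
  have h0 : (0 : L) ∈ p.roots := by
    rw [mem_roots', IsRoot, hp, eval_map_algebraMap, aeval_poly, map_zero, and_iff_left rfl]
    refine Polynomial.map_ne_zero ?_
    rw [← leadingCoeff_ne_zero, poly_eq, (aeval_op_X_natDegree (generator_ne_zero hf)).2, Ne, map_eq_zero, leadingCoeff_eq_zero]
    exact generator_ne_zero hf
  have h1 := (IsSplittingField.splits L (poly K f)).eq_prod_roots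
  rw [← hp, ← Multiset.cons_erase h0, Multiset.map_cons, Multiset.prod_cons, C_0, sub_zero] at h1
  have h2 := congrArg (fun r => eval 0 (derivative r)) h1
  have h3 : p.leadingCoeff = algebraMap k L f.leadingCoeff := by
    rw [hp, leadingCoeff_map, poly_eq, (aeval_op_X_natDegree (generator_ne_zero hf)).2,
      IsScalarTower.algebraMap_apply k k[X] K, ← IsScalarTower.algebraMap_apply k[X] K L, ← IsScalarTower.algebraMap_apply]
  simp only [derivative_mul, derivative_C, derivative_X, eval_add, eval_mul, eval_C, eval_X, zero_mul, zero_add, one_mul, add_zero] at h2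
  rw [hp, derivative_map, poly_eq, derivative_aeval_op, derivative_X, mul_one, Polynomial.algebraMap_apply, map_C, eval_C,
    ← IsScalarTower.algebraMap_apply, ← poly_eq, ← hp, h3, eval_multiset_prod, Multiset.map_map] at h2
  rw [h2]
  congr 3
  ext r
  simp

omit hf [Algebra k L] [IsScalarTower k k[X] L] [Fintype k] in
theorem exists_prod_map_eq_mul (s : Multiset L) (g h : L → L)
    (hgh : ∀ r ∈ s, ∃ v : IntClosure k L, g r = v * h r) :
    ∃ v : IntClosure k L, (s.map g).prod = v * (s.map h).prod := by
  induction s using Multiset.induction with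
  | empty => exact ⟨1, by simp⟩
  | cons r s ih =>
    obtain ⟨v, hv⟩ := hgh r (Multiset.mem_cons_self r s)
    obtain ⟨w, hw⟩ := ih fun r hr => hgh r (Multiset.mem_cons_of_mem hr)
    refine ⟨v * w, ?_⟩
    rw [Multiset.map_cons, Multiset.map_cons, Multiset.prod_cons, Multiset.prod_cons, hv, hw]
    push_cast
    ring

omit hf in
/-- A torsion point as an element of the integral closure of `k[X]`. -/
noncomputable def torsionInt (x : Torsion 𝔭 L) : IntClosure k L :=
  ⟨torsionCoord x, isIntegral_torsionCoord x⟩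

omit hf in
theorem coe_torsionInt (x : Torsion 𝔭 L) : (torsionInt x : L) = torsionCoord x := rfl

omit hf in
theorem exists_eq_mul_of_eq_aeval_op {x y : Torsion 𝔭 L} {a : k[X]}
    (h : torsionCoord y = aeval (op k L) a (torsionCoord x)) :
    ∃ v : IntClosure k L, torsionCoord y = v * torsionCoord x := by
  obtain ⟨v, hv⟩ := dvd_aeval_op a (torsionInt x)
  refine ⟨v, ?_⟩
  have h1 := map_aeval_op (IntClosure k L).val a (torsionInt x)
  rw [hv, map_mul] at h1
  rw [h, mul_comm]
  exact h1.symm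

variable [(poly K f).IsSplittingField K L]

variable (K) in
include hlam in
/-- The ideal `𝔓` is generated by `lam`, the extension is totally ramified at `𝔭`, and the character
`χ` is an isomorphism onto the units of the residue field. -/
theorem torsionField_ramification (𝔓 : Ideal (IntClosure k L)) [h𝔓 : 𝔓.IsPrime]
    [𝔓.LiesOver 𝔭.asIdeal] :
    𝔓 = Ideal.span {torsionInt lam} ∧
    (∀ r : IntClosure k L, ∃ a : k[X], r - algebraMap k[X] _ a ∈ 𝔓) ∧
    (∀ a ∈ 𝔭.asIdeal, torsionInt lam ^
      (Fintype.card k ^ Module.finrank k (k[X] ⧸ 𝔭.asIdeal) - 1) ∣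
        algebraMap k[X] (IntClosure k L) a) ∧
    Function.Bijective (chi 𝔭 : (L ≃ₐ[K] L) →* k[X] ⧸ 𝔭.asIdeal).toHomUnits := by
  classical
  let _ : Field (k[X] ⧸ 𝔭.asIdeal) := Ideal.Quotient.field _
  set Q := Fintype.card k ^ Module.finrank k (k[X] ⧸ 𝔭.asIdeal) with hQ
  have hq : 1 < Fintype.card k := Fintype.one_lt_card
  have hf0 := generator_ne_zero hf
  have hfinF : Module.Finite k (k[X] ⧸ 𝔭.asIdeal) := by
    rw [hf]
    exact (AdjoinRoot.powerBasis hf0).finite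
  have : Finite (k[X] ⧸ 𝔭.asIdeal) := Module.finite_of_finite k
  let _ : Fintype (k[X] ⧸ 𝔭.asIdeal) := Fintype.ofFinite _
  have hcardF : Fintype.card (k[X] ⧸ 𝔭.asIdeal) = Q := Module.card_eq_pow_finrank
  have hQ1 : 1 < Q := hcardF ▸ Fintype.one_lt_card
  have hsep := separable_poly (K := K) hf
  have : FiniteDimensional K L := IsSplittingField.finiteDimensional L (poly K f)
  have : IsGalois K L := IsGalois.of_separable_splitting_field hsep
  have : IsDedekindDomain (IntClosure k L) := integralClosure.isDedekindDomain k[X] K L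
  have : Module.Finite k[X] (IntClosure k L) := IsIntegralClosure.finite k[X] K L (IntClosure k L)
  have : IsFractionRing (IntClosure k L) L := integralClosure.isFractionRing_of_finite_extension K L
  have : FaithfulSMul k[X] L := FaithfulSMul.trans k[X] K L
  have hinj : Function.Injective (algebraMap k[X] (IntClosure k L)) :=
    FaithfulSMul.algebraMap_injective k[X] (IntClosure k L)
  have hlam0 := torsionCoord_ne_zero K hf hlam
  set p := (poly K f).map (algebraMap K L) with hp
  set s := p.roots.erase 0 with hs
  have hroot : ∀ r ∈ s, ∃ y : Torsion 𝔭 L, y ≠ 0 ∧ torsionCoord y = r := by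
    intro r hr
    rw [hs, (nodup_roots hsep.map).mem_erase_iff] at hr
    have h1 : r ∈ (poly K f).rootSet L := by
      rw [rootSet_def, Finset.mem_coe, Multiset.mem_toFinset]
      exact hr.2
    obtain ⟨y, hy⟩ := (mem_rootSet_poly_iff hf).1 h1
    refine ⟨y, ?_, hy⟩
    rintro rfl
    exact hr.1 (hy.symm.trans torsionCoord_zero)
  have hcards : s.card = Q - 1 := by
    have h0 : (0 : L) ∈ p.roots := by
      have h1 : (0 : L) ∈ (poly K f).rootSet L :=
        (mem_rootSet_poly_iff hf).2 ⟨0, torsionCoord_zero⟩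
      rw [rootSet_def, Finset.mem_coe, Multiset.mem_toFinset] at h1
      exact h1
    rw [hs, Multiset.card_erase_of_mem h0, ← (IsSplittingField.splits L (poly K f)).natDegree_eq_card_roots,
      natDegree_map, natDegree_poly hf]
    rfl
  have hprod := algebraMap_generator_eq K L hf
  rw [← hp, ← hs] at hprod
  have hlc : f.leadingCoeff ≠ 0 := leadingCoeff_ne_zero.2 hf0
  have halg : ∀ c : k, (algebraMap k (IntClosure k L) c : L) = algebraMap k L c := fun _ => rfl
  have halg' : ∀ a : k[X], (algebraMap k[X] (IntClosure k L) a : L) = algebraMap k[X] L a :=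
    fun _ => rfl
  -- Each of the Q-1 nonzero torsion points is φ(a)(λ) for some a, hence divisible by λ, and their
  -- product is f up to a unit.
  have hram : ∀ a ∈ 𝔭.asIdeal, torsionInt lam ^ (Q - 1) ∣ algebraMap k[X] (IntClosure k L) a := by
    intro a ha
    rw [hf, Ideal.mem_span_singleton] at ha
    refine Dvd.dvd.trans ?_ (map_dvd _ ha)
    obtain ⟨v, hv⟩ := exists_prod_map_eq_mul (k := k) s (fun r => -r) (fun _ => torsionCoord lam) (by
      intro r hr
      obtain ⟨y, -, rfl⟩ := hroot r hr
      obtain ⟨a, ha⟩ := exists_aeval_op_eq hlam y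
      obtain ⟨v, hv⟩ := exists_eq_mul_of_eq_aeval_op ha
      exact ⟨-v, by push_cast; rw [hv]; ring⟩)
    rw [Multiset.map_const', Multiset.prod_replicate, hcards] at hv
    refine ⟨algebraMap k _ f.leadingCoeff * v, Subtype.ext ?_⟩
    simp only [MulMemClass.coe_mul, SubmonoidClass.coe_pow, halg, halg', coe_torsionInt]
    rw [hprod, hv]
    ring
  -- Conversely λ is divisible by every nonzero torsion point, so λ^(Q-1) is a multiple of f.
  have hmem : torsionInt lam ∈ 𝔓 := by
    obtain ⟨v, hv⟩ := exists_prod_map_eq_mul (k := k) s (fun _ => torsionCoord lam) (fun r => -r) (by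
      intro r hr
      obtain ⟨y, hy, rfl⟩ := hroot r hr
      obtain ⟨a, ha⟩ := exists_aeval_op_eq' hlam hy
      obtain ⟨v, hv⟩ := exists_eq_mul_of_eq_aeval_op ha
      exact ⟨-v, by push_cast; rw [hv]; ring⟩)
    rw [Multiset.map_const', Multiset.prod_replicate, hcards] at hv
    have hfmem : algebraMap k[X] (IntClosure k L) f ∈ 𝔓 :=
      (Ideal.mem_of_liesOver 𝔓 𝔭.asIdeal f).1 (hf ▸ Ideal.mem_span_singleton_self f)
    refine h𝔓.mem_of_pow_mem (Q - 1) ?_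
    have heq : torsionInt lam ^ (Q - 1) =
        algebraMap k _ f.leadingCoeff⁻¹ * v * algebraMap k[X] (IntClosure k L) f := by
      refine Subtype.ext ?_
      simp only [MulMemClass.coe_mul, SubmonoidClass.coe_pow, halg, halg', coe_torsionInt]
      rw [hprod, hv, map_inv₀]
      have : algebraMap k L f.leadingCoeff ≠ 0 := (_root_.map_ne_zero _).2 hlc
      field_simp
    rw [heq]
    exact Ideal.mul_mem_left _ _ hfmem
  have hchi := chi_injective (K := K) hf hlam
  have hcardG : Nat.card (L ≃ₐ[K] L) = Module.finrank k[X] (IntClosure k L) := by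
    rw [IsGalois.card_aut_eq_finrank, IsFractionRing.finrank_eq k[X] K (IntClosure k L) L]
  have hcardU : Nat.card (k[X] ⧸ 𝔭.asIdeal)ˣ = Q - 1 := by
    rw [Nat.card_eq_fintype_card, Fintype.card_units, hcardF]
  have hle : Module.finrank k[X] (IntClosure k L) ≤ Q - 1 := by
    rw [← hcardG, ← hcardU]
    exact Nat.card_le_card_of_injective _ hchi
  have hp0 : 𝔭.asIdeal.map (algebraMap k[X] (IntClosure k L)) ≠ ⊥ := by
    rw [Ne, Ideal.map_eq_bot_iff_of_injective hinj]
    exact 𝔭.ne_bot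
  obtain ⟨h1, h2, h3⟩ := totally_ramified_of_pow_dvd 𝔭.asIdeal 𝔓 hp0 hmem
    (Nat.sub_ne_zero_of_lt hQ1) hram hle
  refine ⟨h2, h3, hram, ?_⟩
  rw [Nat.bijective_iff_injective_and_card, hcardG, h1, hcardU]
  exact ⟨hchi, rfl⟩

end TorsionField

end Carlitz

namespace Carlitz

/-! ### Isotypical projections for F^× -/

section IsotypicProjection

variable {F V : Type*} [Field F] [Fintype F] [DecidableEq F] [AddCommGroup V] [Module F V]

theorem sum_units_inv_pow_mul_pow' {n j : ℕ} (hn : n ∈ Finset.Icc 1 (Fintype.card F - 1))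
    (hj : j ∈ Finset.Icc 1 (Fintype.card F - 1)) :
    ∑ a : Fˣ, ((a⁻¹ : Fˣ) : F) ^ n * (a : F) ^ j = if j = n then -1 else 0 := by
  rw [Finset.mem_Icc] at hn hj
  rw [sum_units_inv_pow_mul_pow_eq hn.2]
  simp only [dvd_add_sub_iff hn.2 (show j + (Fintype.card F - 1 - n) < _ by omega) (by omega)]

theorem sum_Icc_inv_pow (a : Fˣ) :
    ∑ n ∈ Finset.Icc 1 (Fintype.card F - 1), ((a⁻¹ : Fˣ) : F) ^ n = if a = 1 then -1 else 0 := by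
  have hF : 1 < Fintype.card F := Fintype.one_lt_card
  split_ifs with h
  · subst h
    simp only [inv_one, Units.val_one, one_pow, Finset.sum_const, Nat.card_Icc, nsmul_eq_mul, mul_one]
    rw [Nat.add_sub_cancel, Nat.cast_sub hF.le, FiniteField.cast_card_eq_zero, Nat.cast_one, zero_sub]
  · set b : F := ((a⁻¹ : Fˣ) : F)
    have hb : b - 1 ≠ 0 := by
      rw [sub_ne_zero]
      intro hb
      exact h (inv_eq_one.1 (Units.ext hb))
    have h1 : ∑ n ∈ Finset.Icc 1 (Fintype.card F - 1), b ^ n =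
        b * ∑ i ∈ Finset.range (Fintype.card F - 1), b ^ i := by
      rw [Finset.mul_sum, show Finset.Icc 1 (Fintype.card F - 1) = Finset.Ico 1 (Fintype.card F) by
        ext i; simp only [Finset.mem_Icc, Finset.mem_Ico]; omega, Finset.sum_Ico_eq_sum_range]
      exact Finset.sum_congr rfl fun i _ => by rw [pow_add, pow_one]
    rw [h1]
    refine mul_eq_zero_of_right _ ?_
    have h2 := geom_sum_mul b (Fintype.card F - 1)
    rw [FiniteField.pow_card_sub_one_eq_one b (a⁻¹).ne_zero, sub_self, mul_eq_zero] at h2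
    exact h2.resolve_right hb

/-- The projection onto the component on which `a` acts as `a ^ n`. -/
noncomputable def isotypicProj (T : Fˣ → V →ₗ[F] V) (n : ℕ) (m : V) : V :=
  -∑ a : Fˣ, (((a⁻¹ : Fˣ) : F) ^ n) • T a m

theorem map_isotypicProj {T : Fˣ → V →ₗ[F] V} (hmul : ∀ a b m, T (a * b) m = T a (T b m)) (n : ℕ)
    (m : V) (b : Fˣ) : T b (isotypicProj T n m) = (b : F) ^ n • isotypicProj T n m := by
  rw [isotypicProj, map_neg, smul_neg, map_sum, neg_inj, ← Equiv.sum_comp (Equiv.mulLeft b) fun a : Fˣ => (((a⁻¹ : Fˣ) : F) ^ n) • T a m, Finset.smul_sum]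
  refine Finset.sum_congr rfl fun a _ => ?_
  rw [map_smul, ← hmul, Equiv.coe_mulLeft, smul_smul, mul_inv, Units.val_mul, mul_pow, ← mul_assoc,
    ← mul_pow, Units.mul_inv, one_pow, one_mul]

/-- Summing over all characters isolates a = 1, with multiplicity Q-1 = -1 in `F`; this explains the
sign in `isotypicProj`. -/
theorem sum_isotypicProj {T : Fˣ → V →ₗ[F] V} (hone : ∀ m, T 1 m = m) (m : V) :
    ∑ n ∈ Finset.Icc 1 (Fintype.card F - 1), isotypicProj T n m = m := by
  simp only [isotypicProj]
  rw [Finset.sum_neg_distrib, Finset.sum_comm]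
  simp only [← Finset.sum_smul, sum_Icc_inv_pow, ite_smul, zero_smul]
  rw [Finset.sum_ite_eq' Finset.univ (1 : Fˣ), if_pos (Finset.mem_univ _), hone, neg_smul, one_smul, neg_neg]

theorem isotypicProj_sum {T : Fˣ → V →ₗ[F] V} {ℓ : ℕ → V}
    (hℓ : ∀ n ∈ Finset.Icc 1 (Fintype.card F - 1), ∀ a : Fˣ, T a (ℓ n) = (a : F) ^ n • ℓ n)
    {n : ℕ} (hn : n ∈ Finset.Icc 1 (Fintype.card F - 1)) :
    isotypicProj T n (∑ j ∈ Finset.Icc 1 (Fintype.card F - 1), ℓ j) = ℓ n := by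
  simp only [isotypicProj, map_sum, Finset.smul_sum]
  rw [Finset.sum_comm, ← Finset.sum_neg_distrib, Finset.sum_eq_single_of_mem n hn]
  · simp only [hℓ n hn, smul_smul]
    rw [← Finset.sum_smul, sum_units_inv_pow_mul_pow' hn hn, if_pos rfl, neg_smul, one_smul, neg_neg]
  · intro j hj hjn
    simp only [hℓ j hj, smul_smul]
    rw [← Finset.sum_smul, sum_units_inv_pow_mul_pow' hn hj, if_neg hjn, zero_smul, neg_zero]

end IsotypicProjection

/-! ### Injectivity of the restriction of unit classes -/

section Purity

/-- An injective map of abelian groups with torsion-free cokernel stays injective after tensoring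
with any abelian group. -/
theorem lTensor_injective_of_torsionFree {M N N' : Type*} [AddCommGroup M] [AddCommGroup N]
    [AddCommGroup N'] (φ : N →ₗ[ℤ] N') (hφ : Function.Injective φ)
    (htf : ∀ (n : ℤ) (x : N'), n ≠ 0 → n • x ∈ LinearMap.range φ → x ∈ LinearMap.range φ) :
    Function.Injective (φ.lTensor M) := by
  have : Module.IsTorsionFree ℤ (N' ⧸ LinearMap.range φ) := by
    refine ⟨fun n hn => ?_⟩
    have hn0 : n ≠ 0 := hn.ne_zero
    intro x y hxy
    obtain ⟨x, rfl⟩ := Submodule.Quotient.mk_surjective _ x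
    obtain ⟨y, rfl⟩ := Submodule.Quotient.mk_surjective _ y
    simp only [← Submodule.Quotient.mk_smul] at hxy
    rw [Submodule.Quotient.eq] at hxy ⊢
    rw [← smul_sub] at hxy
    exact htf n _ hn0 hxy
  let π : (M →₀ ℤ) →ₗ[ℤ] M := Finsupp.linearCombination ℤ id
  have hπ : Function.Surjective π := Finsupp.linearCombination_id_surjective ℤ M
  -- Cover `M` by a free module. The diagram chase needs the cokernel to be flat, which holds for
  -- torsion-free ℤ-modules, and injectivity after tensoring with the free module.
  refine lTensor_injective_of_exact_of_exact_of_rTensor_injective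
    (f₁ := (LinearMap.ker π).subtype) (f₂ := π) (g₁ := φ) (g₂ := (LinearMap.range φ).mkQ)
    (LinearMap.exact_subtype_ker_map π) hπ (LinearMap.exact_map_mkQ_range φ)
    (Submodule.mkQ_surjective _) ?_ ?_
  · exact Module.Flat.rTensor_preserves_injective_linearMap _ (Submodule.subtype_injective _)
  · exact Module.Flat.lTensor_preserves_injective_linearMap _ hφ

variable {k : Type*} [Field k] [Fintype k] (𝔭 : HeightOneSpectrum k[X])
  {L : Type*} [Field L] [Algebra k[X] L]

/-- An element with an integral power is integral; applied to v and its inverse this shows that the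
cokernel of R^× in the punctured units is torsion-free. -/
theorem exists_unit_of_pow_eq {v : (PuncturedSections 𝔭 L)ˣ} {n : ℕ} (hn : n ≠ 0)
    {r : (IntClosure k L)ˣ} (h : ((v : PuncturedSections 𝔭 L) : L) ^ n = (r : IntClosure k L)) :
    ∃ w : (IntClosure k L)ˣ, ((w : IntClosure k L) : L) = (v : PuncturedSections 𝔭 L) := by
  have hv : ((v : PuncturedSections 𝔭 L) : L) * ((v⁻¹ : (PuncturedSections 𝔭 L)ˣ) : PuncturedSections 𝔭 L) = 1 :=
    congrArg Subtype.val v.mul_inv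
  have hr : ((r : IntClosure k L) : L) * ((r⁻¹ : (IntClosure k L)ˣ) : IntClosure k L) = 1 :=
    congrArg Subtype.val r.mul_inv
  have h' : (((v⁻¹ : (PuncturedSections 𝔭 L)ˣ) : PuncturedSections 𝔭 L) : L) ^ n =
      ((r⁻¹ : (IntClosure k L)ˣ) : IntClosure k L) := by
    have h1 : ((v : PuncturedSections 𝔭 L) : L) ^ n * (((v⁻¹ : (PuncturedSections 𝔭 L)ˣ) : PuncturedSections 𝔭 L) : L) ^ n = 1 := by
      rw [← mul_pow, hv, one_pow]
    rw [h] at h1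
    exact mul_left_cancel₀ (left_ne_zero_of_mul_eq_one hr) (h1.trans hr.symm)
  have hint : ∀ (x : L) (y : IntClosure k L), x ^ n = y → IsIntegral k[X] x := fun x y hxy =>
    IsIntegral.of_pow (Nat.pos_of_ne_zero hn) (hxy ▸ y.2)
  exact ⟨⟨⟨_, hint _ _ h⟩, ⟨_, hint _ _ h'⟩, Subtype.ext hv, Subtype.ext ((mul_comm _ _).trans hv)⟩,
    rfl⟩

theorem restrict_injective : Function.Injective (restrict 𝔭 L) := by
  refine lTensor_injective_of_torsionFree _ ?_ ?_
  · intro x y hxy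
    have h : (((x.toMul : (IntClosure k L)ˣ) : IntClosure k L) : L) =
        ((y.toMul : (IntClosure k L)ˣ) : IntClosure k L) :=
      congrArg (fun z : Additive (PuncturedSections 𝔭 L)ˣ =>
        (((z.toMul : (PuncturedSections 𝔭 L)ˣ) : PuncturedSections 𝔭 L) : L)) hxy
    exact Additive.toMul.injective (Units.ext (Subtype.ext h))
  · intro n x hn
    rintro ⟨r, hr⟩
    have key : ∀ (N : ℕ) (r : Additive (IntClosure k L)ˣ), N ≠ 0 →
        AddMonoidHom.toIntLinearMap (MonoidHom.toAdditive (Units.map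
          (algebraMap (IntClosure k L) (PuncturedSections 𝔭 L)).toMonoidHom)) r = N • x →
        ∃ w, AddMonoidHom.toIntLinearMap (MonoidHom.toAdditive (Units.map
          (algebraMap (IntClosure k L) (PuncturedSections 𝔭 L)).toMonoidHom)) w = x := by
      intro N r hN hr
      have h := congrArg (fun z : Additive (PuncturedSections 𝔭 L)ˣ =>
        (((z.toMul : (PuncturedSections 𝔭 L)ˣ) : PuncturedSections 𝔭 L) : L)) hr
      obtain ⟨w, hw⟩ := exists_unit_of_pow_eq 𝔭 (v := x.toMul) (r := r.toMul) hN h.symm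
      exact ⟨Additive.ofMul w, Additive.toMul.injective (Units.ext (Subtype.ext hw))⟩
    obtain ⟨N, rfl | rfl⟩ := n.eq_nat_or_neg
    · exact key N r (by simpa using hn) (by rw [hr, natCast_zsmul])
    · exact key N (-r) (by simpa using hn) (by rw [map_neg, hr, neg_smul, neg_neg, natCast_zsmul])

end Purity

end Carlitz

namespace Carlitz

/-! ### Galois action on unit classes -/

section GaloisAction

variable {k K L : Type*} [Field k] [Fintype k] [Field K] [Algebra k[X] K]
  [Field L] [Algebra K L] [Algebra k[X] L] [IsScalarTower k[X] K L] {𝔭 : HeightOneSpectrum k[X]}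

theorem galClasses_one (m : PuncturedUnitClasses 𝔭 L) :
    galClasses 𝔭 (1 : L ≃ₐ[K] L) m = m :=
  DFunLike.congr_fun (LinearMap.baseChange_id (A := k[X] ⧸ 𝔭.asIdeal) (R := ℤ)
    (M := Additive (PuncturedSections 𝔭 L)ˣ)) m

theorem galClasses_mul (g h : L ≃ₐ[K] L) (m : PuncturedUnitClasses 𝔭 L) :
    galClasses 𝔭 (g * h) m = galClasses 𝔭 g (galClasses 𝔭 h m) :=
  DFunLike.congr_fun (LinearMap.baseChange_comp (A := k[X] ⧸ 𝔭.asIdeal)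
    (f := AddMonoidHom.toIntLinearMap (MonoidHom.toAdditive (Units.map (galSections 𝔭 h))))
    (g := AddMonoidHom.toIntLinearMap (MonoidHom.toAdditive (Units.map (galSections 𝔭 g))))) m

theorem galClasses_tmul (g : L ≃ₐ[K] L) (c : k[X] ⧸ 𝔭.asIdeal) (u : (PuncturedSections 𝔭 L)ˣ) :
    galClasses 𝔭 g (c ⊗ₜ Additive.ofMul u) =
      c ⊗ₜ Additive.ofMul (Units.map (galSections 𝔭 g) u) := rfl

theorem restrict_tmul (c : k[X] ⧸ 𝔭.asIdeal) (u : (IntClosure k L)ˣ) :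
    restrict 𝔭 L (c ⊗ₜ Additive.ofMul u) = c ⊗ₜ Additive.ofMul
      (Units.map (algebraMap (IntClosure k L) (PuncturedSections 𝔭 L)).toMonoidHom u) := rfl

/-- An element of `R` dividing a power of `𝔭` is invertible away from `𝔭`. -/
theorem exists_punctured_unit {x : IntClosure k L} (hx : (x : L) ≠ 0)
    (h : ∀ a ∈ 𝔭.asIdeal, x ∣ algebraMap k[X] (IntClosure k L) a) :
    ∃ u : (PuncturedSections 𝔭 L)ˣ, ((u : PuncturedSections 𝔭 L) : L) = x := by
  have hinv : (x : L)⁻¹ ∈ PuncturedSections 𝔭 L := by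
    intro 𝔮 h𝔮 hover
    obtain ⟨a, ha, haq⟩ : ∃ a ∈ 𝔭.asIdeal, algebraMap k[X] (IntClosure k L) a ∉ 𝔮 := by
      by_contra! hcon
      exact hover ⟨𝔭.isMaximal.eq_of_le (Ideal.comap_ne_top _ h𝔮.ne_top) hcon⟩
    obtain ⟨v, hv⟩ := h a ha
    refine ⟨v, _, haq, ?_⟩
    rw [hv, MulMemClass.coe_mul, mul_right_comm, mul_inv_cancel₀ hx, one_mul]
  exact ⟨⟨algebraMap (IntClosure k L) (PuncturedSections 𝔭 L) x, ⟨(x : L)⁻¹, hinv⟩,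
    Subtype.ext (mul_inv_cancel₀ hx), Subtype.ext (inv_mul_cancel₀ hx)⟩, rfl⟩

variable [Algebra k L] [IsScalarTower k k[X] L]

/-- The conjugate g(λ) is some φ(a)(λ), hence divisible by λ. The same for the inverse of g shows
that the quotient is a unit. -/
theorem exists_unit_mul_torsionCoord {lam : Torsion 𝔭 L}
    (hlam : Submodule.span (k[X] ⧸ 𝔭.asIdeal) {lam} = ⊤) (hlam0 : torsionCoord lam ≠ 0)
    (g : L ≃ₐ[K] L) :
    ∃ v : (IntClosure k L)ˣ, g (torsionCoord lam) = (v : IntClosure k L) * torsionCoord lam := by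
  have h : ∀ g : L ≃ₐ[K] L, ∃ v : IntClosure k L, g (torsionCoord lam) = v * torsionCoord lam := by
    intro g
    obtain ⟨a, ha⟩ := exists_aeval_op_eq hlam (rep 𝔭 g lam)
    exact exists_eq_mul_of_eq_aeval_op ha
  obtain ⟨v, hv⟩ := h g
  obtain ⟨w, hw⟩ := h g⁻¹
  let w' : IntClosure k L := (overA (k := k) g).mapIntegralClosure w
  have hw' : (w' : L) = g w := rfl
  have h1 : (v : L) * w' = 1 := by
    have h2 := congrArg g hw
    rw [map_mul, hv, ← hw', show g (g⁻¹ (torsionCoord lam)) = torsionCoord lam from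
      g.apply_symm_apply _] at h2
    refine mul_right_cancel₀ hlam0 ?_
    rw [one_mul, mul_comm (v : L), mul_assoc, ← h2]
  exact ⟨⟨v, w', Subtype.ext h1, Subtype.ext ((mul_comm _ _).trans h1)⟩, hv⟩

end GaloisAction

end Carlitz

/-! ### The main theorem -/

theorem mainTheorem3 {k K L : Type*} [Field k] [Fintype k]
    [Field K] [Algebra k K] [Algebra k[X] K] [IsScalarTower k k[X] K] [IsFractionRing k[X] K]
    [Field L] [Algebra K L] [Algebra k L] [Algebra k[X] L] [IsScalarTower k k[X] L]
    [IsScalarTower k[X] K L]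
    (𝔭 : HeightOneSpectrum k[X]) (d : ℕ) (hd : d = Module.finrank k (k[X] ⧸ 𝔭.asIdeal))
    (hL : Carlitz.IsTorsionSplittingField 𝔭 K L)
    (𝔓 : Ideal (integralClosure k[X] L)) [𝔓.IsPrime] [𝔓.LiesOver 𝔭.asIdeal]
    (lam : Carlitz.Torsion 𝔭 L) (hlam : Submodule.span (k[X] ⧸ 𝔭.asIdeal) {lam} = ⊤) :
    ∃ u : (Carlitz.PuncturedSections 𝔭 L)ˣ, ((u : Carlitz.PuncturedSections 𝔭 L) : L) = Carlitz.torsionCoord lam ∧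
      (∃ ℓ, Carlitz.IsIsotypicDecomposition 𝔭 K (1 ⊗ₜ[ℤ] Additive.ofMul u) ℓ) ∧
      ∀ ℓ, Carlitz.IsIsotypicDecomposition 𝔭 K (1 ⊗ₜ[ℤ] Additive.ofMul u) ℓ →
        ∀ n : ℕ, 1 ≤ n → n < Fintype.card k ^ d - 1 →
          (∃! w, Carlitz.restrict 𝔭 L w = ℓ n) ∧
          ∀ w, Carlitz.restrict 𝔭 L w = ℓ n →
            (𝔭.valuation K (Carlitz.BC k K n) < 1 ↔
              Carlitz.reduceDifferentials 𝔭 𝔓 (Fintype.card k ^ d) (Carlitz.dlog 𝔭 w) = 0) := by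
  classical
  subst hd
  obtain ⟨f, hf, hsplit⟩ := hL
  let _ : Field (k[X] ⧸ 𝔭.asIdeal) := Carlitz.residueField 𝔭
  have : Module.Finite k (k[X] ⧸ 𝔭.asIdeal) := by
    rw [hf]
    exact (AdjoinRoot.powerBasis (Carlitz.generator_ne_zero hf)).finite
  have : Finite (k[X] ⧸ 𝔭.asIdeal) := Module.finite_of_finite k
  let _ : Fintype (k[X] ⧸ 𝔭.asIdeal) := Fintype.ofFinite _
  have hQ : Fintype.card (k[X] ⧸ 𝔭.asIdeal) =
      Fintype.card k ^ Module.finrank k (k[X] ⧸ 𝔭.asIdeal) := Module.card_eq_pow_finrank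
  obtain ⟨h𝔓, hres, hram, hbij⟩ := Carlitz.torsionField_ramification K hf hlam 𝔓
  have hlam0 := Carlitz.torsionCoord_ne_zero K hf hlam
  have hint0 : Carlitz.torsionInt lam ≠ 0 := fun h => hlam0 (congrArg Subtype.val h)
  have hQ1 : 1 < Fintype.card (k[X] ⧸ 𝔭.asIdeal) := Fintype.one_lt_card
  obtain ⟨u, hu⟩ := Carlitz.exists_punctured_unit (𝔭 := 𝔭) (x := Carlitz.torsionInt lam) hlam0
    fun a ha => (dvd_pow_self _ (by rw [← hQ]; omega)).trans (hram a ha)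
  -- Indexing the Galois group by F^× through χ turns the isotypical components into twisted sums
  -- over F^×.
  let e : (L ≃ₐ[K] L) ≃* (k[X] ⧸ 𝔭.asIdeal)ˣ := MulEquiv.ofBijective _ hbij
  have he : ∀ c, Carlitz.chi 𝔭 (e.symm c) = (c : k[X] ⧸ 𝔭.asIdeal) := fun c =>
    congrArg Units.val (e.apply_symm_apply c)
  let T : (k[X] ⧸ 𝔭.asIdeal)ˣ → Carlitz.PuncturedUnitClasses 𝔭 L →ₗ[k[X] ⧸ 𝔭.asIdeal]
    Carlitz.PuncturedUnitClasses 𝔭 L := fun c => Carlitz.galClasses 𝔭 (e.symm c)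
  have hTmul : ∀ a b m, T (a * b) m = T a (T b m) := fun a b m => by
    change Carlitz.galClasses 𝔭 (e.symm (a * b)) m = _
    rw [map_mul, Carlitz.galClasses_mul]
  have hTone : ∀ m, T 1 m = m := fun m => by
    change Carlitz.galClasses 𝔭 (e.symm 1) m = _
    rw [map_one, Carlitz.galClasses_one]
  refine ⟨u, hu, ?_, ?_⟩
  · refine ⟨fun n => Carlitz.isotypicProj T n (1 ⊗ₜ[ℤ] Additive.ofMul u), ?_, ?_⟩
    · intro n _ g
      have h := Carlitz.map_isotypicProj hTmul n (1 ⊗ₜ[ℤ] Additive.ofMul u) (e g)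
      have h1 : T (e g) = Carlitz.galClasses 𝔭 g := by
        change Carlitz.galClasses 𝔭 (e.symm (e g)) = _
        rw [e.symm_apply_apply]
      rw [h1] at h
      exact h
    · rw [← hQ, Carlitz.sum_isotypicProj hTone]
  intro ℓ hℓ n hn hn'
  have hproj : ℓ n = Carlitz.isotypicProj T n (1 ⊗ₜ[ℤ] Additive.ofMul u) := by
    obtain ⟨h1, h2⟩ := hℓ
    rw [← hQ] at h1 h2
    rw [h2]
    refine (Carlitz.isotypicProj_sum (fun j hj a => ?_) (Finset.mem_Icc.2 ⟨hn, by omega⟩)).symm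
    refine (h1 j hj (e.symm a)).trans ?_
    rw [he]
  choose v hv using fun c => Carlitz.exists_unit_mul_torsionCoord hlam hlam0 (e.symm c)
  -- In the projection of 1 ⊗ λ, each g_c λ is replaced by the unit v_c = g_c λ/λ. The discarded
  -- contribution (∑ c^(-n)) ⊗ λ is zero because Q-1 does not divide n.
  set w₀ : Carlitz.UnitClasses 𝔭 L := ∑ c : (k[X] ⧸ 𝔭.asIdeal)ˣ,
      (((c⁻¹ : (k[X] ⧸ 𝔭.asIdeal)ˣ) : k[X] ⧸ 𝔭.asIdeal) ^ n) ⊗ₜ Additive.ofMul (v c) with hw₀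
  have hw : Carlitz.restrict 𝔭 L (-w₀) = ℓ n := by
    have hTu : ∀ c : (k[X] ⧸ 𝔭.asIdeal)ˣ, T c (1 ⊗ₜ[ℤ] Additive.ofMul u) =
        1 ⊗ₜ Additive.ofMul (Units.map
          (algebraMap (Carlitz.IntClosure k L) (Carlitz.PuncturedSections 𝔭 L)).toMonoidHom (v c)) +
        1 ⊗ₜ Additive.ofMul u := by
      intro c
      rw [← TensorProduct.tmul_add, ← ofMul_mul]
      refine (Carlitz.galClasses_tmul (e.symm c) 1 u).trans ?_
      congr 2
      refine Units.ext (Subtype.ext ?_)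
      change e.symm c ((u : Carlitz.PuncturedSections 𝔭 L) : L) =
        ((v c : Carlitz.IntClosure k L) : L) * ((u : Carlitz.PuncturedSections 𝔭 L) : L)
      rw [hu]
      exact hv c
    have hsum := Carlitz.sum_units_inv_pow_mul_pow (F := k[X] ⧸ 𝔭.asIdeal) (m := 0) hn
      (by rw [hQ]; exact hn') (by omega)
    simp only [pow_zero, mul_one] at hsum
    rw [if_neg (by omega)] at hsum
    rw [hproj, map_neg, Carlitz.isotypicProj, hw₀, map_sum]
    simp only [hTu, smul_add, Finset.sum_add_distrib, Carlitz.restrict_tmul,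
      TensorProduct.smul_tmul', smul_eq_mul, mul_one]
    rw [← TensorProduct.sum_tmul, hsum, TensorProduct.zero_tmul, add_zero]
  refine ⟨⟨-w₀, hw, fun w h => Carlitz.restrict_injective 𝔭 (h.trans hw.symm)⟩, ?_⟩
  intro w h
  rw [Carlitz.restrict_injective 𝔭 (h.trans hw.symm), map_neg, map_neg, neg_eq_zero]
  have hA : Function.Surjective (algebraMap k[X] (k[X] ⧸ 𝔭.asIdeal)) :=
    Ideal.Quotient.mk_surjective
  rw [Carlitz.valuation_BC_lt_one_iff hA hQ 𝔭 (fun a => Ideal.Quotient.eq_zero_iff_mem)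
    (by rw [hQ]; exact hn')]
  let σ : (k[X] ⧸ 𝔭.asIdeal)ˣ → integralClosure k[X] L →ₐ[k[X]] integralClosure k[X] L := fun c =>
    ((Carlitz.overA (k := k) (e.symm c)).mapIntegralClosure : _ ≃ₐ[k[X]] _)
  have hσ : ∀ c r, ((σ c r : integralClosure k[X] L) : L) = e.symm c r := fun _ _ => rfl
  have hσlam : ∀ c, σ c (Carlitz.torsionInt lam) = v c * Carlitz.torsionInt lam := fun c =>
    Subtype.ext (hv c)
  refine (Carlitz.reduceDifferentials_dlog_eq_zero_iff hQ hQ h𝔓 (Ideal.IsPrime.ne_top ‹_›) hint0 hres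
    hram σ v hσlam ?_ ?_ hn hn').symm
  · intro b c
    refine mul_right_cancel₀ hint0 ?_
    rw [← hσlam, mul_assoc, ← hσlam, ← map_mul, ← hσlam]
    refine Subtype.ext ?_
    rw [hσ, hσ, hσ, map_mul]
    rfl
  · intro c a ha
    refine Subtype.ext ?_
    have h1 := Carlitz.map_aeval_op (integralClosure k[X] L).val a (Carlitz.torsionInt lam)
    refine Eq.trans ?_ h1.symm
    exact Carlitz.apply_torsionCoord hlam (e.symm c) (ha.trans (he c).symm) lam
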